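/- Let $k$ be a field, not necessarily algebraically closed, of characteristic different from $2$ and $3$, with separable closure $k^{\mathrm{sep}}$ and algebraic closure $\bar k$. Let $\mathcal{I}_4$ be the threefold in $\mathbb{P}^5$ defined by $$\sum_{j=0}^5 x_j=0,\qquad \Big(\sum_{j=0}^5 x_j^2\Big)^2-4\sum_{j=0}^5x_j^4=0,$$ regarded as a quartic hypersurface in the hyperplane $\sum_j x_j=0$, and let $\mathcal{E}_4\subset\mathcal{I}_4$ be the union of its sections by the ten hyperplanes in the orbit of $x_0+x_1+x_2=0$ under permutation of the coordinates. Let $\mathcal{I}\subset\mathbb{P}^4$ be an Igusa quartic over $k$: a quartic hypersurface $F=0$, with $F$ a quartic form over $k$, that a linear isomorphism over $k^{\mathrm{sep}}$ from $\mathbb{P}^4$ to the hyperplane $\sum_j x_j=0$ identifies with $\mathcal{I}_4$; let $\mathcal{E}\subset\mathcal{I}$ be the locus that is mapped to $\mathcal{E}_4$. Write $\mathrm{P}(a,b)=\sum_i \partial_iF(a)\,b_i$; write $T_a\mathcal{I}$ for the tangent space $\mathrm{P}(a,\cdot)=0$ of $\mathcal{I}$ at $a$, and $\mathcal{K}_a=T_a\mathcal{I}\cap\mathcal{I}$.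 A trope of the quartic surface $\mathcal{K}_a\subset T_a\mathcal{I}$ is a plane in $T_a\mathcal{I}$ whose scheme-theoretic intersection with $\mathcal{K}_a$ is a nonsingular conic counted with multiplicity two. Let $a,b\in\mathcal{I}(k)$ be distinct points outside $\mathcal{E}$ with $\mathrm{P}(a,b)=\mathrm{P}(b,a)=0$. Then $T_a\mathcal{I}\cap T_b\mathcal{I}$ is a plane, and it is a trope of both $\mathcal{K}_a$ and $\mathcal{K}_b$. Moreover, the scheme-theoretic intersection $\mathcal{K}_a\cap\mathcal{K}_b$ is a nonsingular conic in this plane, defined over $k$ and counted with multiplicity two, which passes through $a$, through $b$, and through five further points (defined over $\bar k$) that are nodes (ordinary double points) of both $\mathcal{K}_a$ and $\mathcal{K}_b$. -/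

import Mathlib

open scoped LinearAlgebra.Projectivization

noncomputable section

namespace IgusaQuartic

open MvPolynomial

/-! Coordinate vectors of `ℙ⁴` over `k` are functions `Fin 5 → k`, linear subspaces of `ℙ⁴` are
submodules of `Fin 5 → k` (a plane is a submodule of rank 3), and closed subschemes of `ℙ⁴` are
given by homogeneous ideals of `k[x₀, …, x₄]`, the scheme-theoretic intersection being the sum
of ideals. -/

/-! ### Polarity, tangent spaces, linear sections -/

section Forms

variable {K : Type*} [Field K]

/-- The polar pairing `P_F(a, b) = ∑ i, (∂ᵢF)(a) bᵢ`, as a linear form in `b`. -/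
def polar (F : MvPolynomial (Fin 5) K) (a : Fin 5 → K) : (Fin 5 → K) →ₗ[K] K :=
  ∑ i, eval a (pderiv i F) • LinearMap.proj i

/-- The tangent space at the point `a` to the hypersurface `F = 0`, as a linear subspace. -/
def tangentSpace (F : MvPolynomial (Fin 5) K) (a : ℙ K (Fin 5 → K)) : Submodule K (Fin 5 → K) :=
  LinearMap.ker (polar F a.rep)

/-- The second derivative `∑ i j, (∂ᵢ∂ⱼF)(p) vᵢ wⱼ`. -/
def hessian (F : MvPolynomial (Fin 5) K) (p v w : Fin 5 → K) : K :=
  ∑ i, ∑ j, eval p (pderiv i (pderiv j F)) * v i * w j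

/-- The homogeneous ideal of a linear subspace `W`: it is generated by the linear forms that
vanish on `W`. -/
def linearIdeal (W : Submodule K (Fin 5 → K)) : Ideal (MvPolynomial (Fin 5) K) :=
  Ideal.span {l | ∃ c : Fin 5 → K, (∀ w ∈ W, ∑ i, c i * w i = 0) ∧ l = ∑ i, C (c i) * X i}

/-- The ideal of the section by the linear subspace `T` of the hypersurface `F = 0`. -/
def sectionIdeal (T : Submodule K (Fin 5 → K)) (F : MvPolynomial (Fin 5) K) :
    Ideal (MvPolynomial (Fin 5) K) :=
  linearIdeal T ⊔ Ideal.span {F}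

/-- The surface `K_a = T_a I ∩ I`, where `I` is the hypersurface `F = 0`. -/
def kummer (F : MvPolynomial (Fin 5) K) (a : ℙ K (Fin 5 → K)) : Ideal (MvPolynomial (Fin 5) K) :=
  sectionIdeal (tangentSpace F a) F

/-- `W` is a plane and the quadratic form `q` defines a nonsingular conic in it (in characteristic
different from 2): the bilinear form of `q` is nondegenerate on `W`. -/
structure IsConic (W : Submodule K (Fin 5 → K)) (q : MvPolynomial (Fin 5) K) : Prop where
  finrank_eq : Module.finrank K W = 3
  isHomogeneous : q.IsHomogeneous 2
  nonsingular : ∀ w ∈ W, (∀ v ∈ W, polar q w v = 0) → w = 0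

/-- The closed subscheme with ideal `J` is the nonsingular conic `q = 0` in the plane `W`, counted
with multiplicity two in that plane. -/
def IsDoubleConic (J : Ideal (MvPolynomial (Fin 5) K)) (W : Submodule K (Fin 5 → K))
    (q : MvPolynomial (Fin 5) K) : Prop :=
  IsConic W q ∧ J = linearIdeal W ⊔ Ideal.span {q ^ 2}

/-- `W` is a trope of the surface `T ∩ {F = 0}`: a plane in `T` which intersects the surface in a
conic with multiplicity two. -/
def IsTrope (T : Submodule K (Fin 5 → K)) (F : MvPolynomial (Fin 5) K)
    (W : Submodule K (Fin 5 → K)) : Prop :=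
  W ≤ T ∧ ∃ q, IsDoubleConic (linearIdeal W ⊔ sectionIdeal T F) W q

/-- The points of the conic `q = 0` in the plane `W`. -/
def conicPoints (W : Submodule K (Fin 5 → K)) (q : MvPolynomial (Fin 5) K) :
    Set (ℙ K (Fin 5 → K)) :=
  {p | p.rep ∈ W ∧ eval p.rep q = 0}

/-- `p` is a node (ordinary double point) of the surface `T ∩ {F = 0}`, where `T` has projective
dimension 3: it is a singular point of the surface, and the quadratic form that defines the tangent
cone there, which is given by the second derivative on `T / ⟨p⟩`, is nondegenerate. -/
structure IsNode (T : Submodule K (Fin 5 → K)) (F : MvPolynomial (Fin 5) K)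
    (p : ℙ K (Fin 5 → K)) : Prop where
  finrank_eq : Module.finrank K T = 4
  mem : p.rep ∈ T
  eval_eq : eval p.rep F = 0
  singular : ∀ v ∈ T, polar F p.rep v = 0
  nondegenerate : ∀ v ∈ T, (∀ w ∈ T, hessian F p.rep v w = 0) → v ∈ Submodule.span K {p.rep}

end Forms

/-! ### Base change -/

section BaseChange

variable {k : Type*} [Field k] (L : Type*) [Field L] [Algebra k L]

/-- The inclusion `k⁵ → L⁵` for a field extension `L` of `k`. -/
def coordMap : (Fin 5 → k) →ₛₗ[algebraMap k L] (Fin 5 → L) where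
  toFun x i := algebraMap k L (x i)
  map_add' x y := by ext i; simp
  map_smul' c x := by ext i; simp

theorem coordMap_injective : Function.Injective (coordMap (k := k) L) := fun x y h => by
  ext i
  exact (algebraMap k L).injective (congrFun h i)

/-- A `k`-point of `ℙ⁴` viewed as an `L`-point. -/
def pointMap : ℙ k (Fin 5 → k) → ℙ L (Fin 5 → L) :=
  Projectivization.map (coordMap L) (coordMap_injective L)

end BaseChange

/-! ### Igusa quartics -/

section Igusa

/-- The quartic form `(∑ xⱼ²)² - 4 ∑ xⱼ⁴` in six variables. -/
def igusaForm (L : Type*) [Field L] : MvPolynomial (Fin 6) L :=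
  (∑ j, X j ^ 2) ^ 2 - 4 * ∑ j, X j ^ 4

/-- The hyperplane `∑ xⱼ = 0` in `L⁶`; the threefold `I₄` is the locus of `igusaForm L` in it. -/
def sumZero (L : Type*) [Field L] : Submodule L (Fin 6 → L) :=
  LinearMap.ker (∑ j, LinearMap.proj j : (Fin 6 → L) →ₗ[L] L)

variable {k : Type*} [Field k]

/-- The linear isomorphism `φ` from `L⁵` to the hyperplane `∑ xⱼ = 0` in `L⁶` induces an isomorphism
over `L` from the hypersurface `F = 0` in `ℙ⁴` to `I₄`: substituting `φ` into the form that
defines `I₄` gives `F`, up to a nonzero constant. -/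
def IsIsoToIgusa (L : Type*) [Field L] [Algebra k L] (F : MvPolynomial (Fin 5) k)
    (φ : (Fin 5 → L) ≃ₗ[L] sumZero L) : Prop :=
  ∃ c : L, c ≠ 0 ∧ map (algebraMap k L) F =
    C c * bind₁ (fun j => ∑ i, C ((φ (Pi.single i 1) : Fin 6 → L) j) * X i) (igusaForm L)

/-- The set of the `k`-points of `ℙ⁴` that `φ` maps to a point on one of the ten hyperplanes in the
`S₆`-orbit of `x₀ + x₁ + x₂ = 0`. The `k`-points of the exceptional locus are those that lie
also on `F = 0`. -/
def exceptional (L : Type*) [Field L] [Algebra k L] (φ : (Fin 5 → L) ≃ₗ[L] sumZero L) :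
    Set (ℙ k (Fin 5 → k)) :=
  {a | ∃ σ : Equiv.Perm (Fin 6),
    let x : Fin 6 → L := φ (coordMap L a.rep)
    x (σ 0) + x (σ 1) + x (σ 2) = 0}

end Igusa

end IgusaQuartic

end

/-!
Polarity sends a point `x` of `I₄` off the ten hyperplanes to a point `γ` of the Segre cubic
`∑ γᵢ = ∑ γᵢ³ = 0`, and `x` is recovered, up to a scalar, as the trace-free part of `(γᵢ²)ᵢ`.
The conditions `P(a, b) = P(b, a) = 0` say that the line through the polar images of `a` and `b`
lies on the Segre cubic. The squares of the points of this line form a conic in `T_a ∩ T_b` through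
`a` and `b`. The first polars of the quartic vanish along the conic in the directions of that plane,
so the quartic restricts to the plane as a constant multiple of the squared equation of the conic.
The five nodes are the squares of the points of the line with `γ₀ + γⱼ = 0`, `j = 1, …, 5`.
-/

noncomputable section

namespace IgusaQuartic

section Polarization

variable {R : Type*} [CommRing R]

/-- The symmetric quadrilinear form with `polar₄ x x x x = 3 ((∑ xⱼ²)² - 4 ∑ xⱼ⁴)`. -/
def polar₄ (a b c d : Fin 6 → R) : R :=
  a ⬝ᵥ b * c ⬝ᵥ d + a ⬝ᵥ c * b ⬝ᵥ d + a ⬝ᵥ d * b ⬝ᵥ c - 12 * ∑ i, a i * b i * c i * d i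

theorem polar₄_swap₁₂ (a b c d : Fin 6 → R) : polar₄ a b c d = polar₄ b a c d := by
  simp only [polar₄, dotProduct_comm b a, mul_comm (b _) (a _)]
  ring

theorem polar₄_swap₂₃ (a b c d : Fin 6 → R) : polar₄ a b c d = polar₄ a c b d := by
  simp only [polar₄, dotProduct_comm c b, mul_right_comm (a _) (c _)]
  ring

theorem polar₄_swap₃₄ (a b c d : Fin 6 → R) : polar₄ a b c d = polar₄ a b d c := by
  simp only [polar₄, dotProduct_comm d c, mul_right_comm _ (d _)]
  ring

theorem polar₄_add₄ (a b c d d' : Fin 6 → R) :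
    polar₄ a b c (d + d') = polar₄ a b c d + polar₄ a b c d' := by
  simp only [polar₄, dotProduct_add, Pi.add_apply, mul_add, Finset.sum_add_distrib]
  ring

theorem polar₄_smul₄ (a b c d : Fin 6 → R) (r : R) :
    polar₄ a b c (r • d) = r * polar₄ a b c d := by
  simp only [polar₄, dotProduct_smul, Pi.smul_apply, smul_eq_mul, mul_left_comm _ r,
    ← Finset.mul_sum]
  ring

theorem polar₄_add₃ (a b c c' d : Fin 6 → R) :
    polar₄ a b (c + c') d = polar₄ a b c d + polar₄ a b c' d := by
  simp only [polar₄_swap₃₄ a b _ d, polar₄_add₄]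

theorem polar₄_smul₃ (a b c d : Fin 6 → R) (r : R) :
    polar₄ a b (r • c) d = r * polar₄ a b c d := by
  simp only [polar₄_swap₃₄ a b _ d, polar₄_smul₄]

theorem polar₄_add₂ (a b b' c d : Fin 6 → R) :
    polar₄ a (b + b') c d = polar₄ a b c d + polar₄ a b' c d := by
  simp only [polar₄_swap₂₃ a _ c d, polar₄_add₃]

theorem polar₄_smul₂ (a b c d : Fin 6 → R) (r : R) :
    polar₄ a (r • b) c d = r * polar₄ a b c d := by
  simp only [polar₄_swap₂₃ a _ c d, polar₄_smul₃]

theorem polar₄_add₁ (a a' b c d : Fin 6 → R) :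
    polar₄ (a + a') b c d = polar₄ a b c d + polar₄ a' b c d := by
  simp only [polar₄_swap₁₂ _ b c d, polar₄_add₂]

theorem polar₄_smul₁ (a b c d : Fin 6 → R) (r : R) :
    polar₄ (r • a) b c d = r * polar₄ a b c d := by
  simp only [polar₄_swap₁₂ _ b c d, polar₄_smul₂]

theorem polar₄_comp_perm (a b c d : Fin 6 → R) (σ : Equiv.Perm (Fin 6)) :
    polar₄ (a ∘ σ) (b ∘ σ) (c ∘ σ) (d ∘ σ) = polar₄ a b c d := by
  simp only [polar₄, comp_equiv_dotProduct_comp_equiv]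
  exact congrArg _ (congrArg _ (Equiv.sum_comp σ fun i => a i * b i * c i * d i))

/-- The polarity of `I₄`: `polar₄ x x x v = gauss x ⬝ᵥ v` when `∑ vⱼ = 0`. -/
def gauss (x : Fin 6 → R) : Fin 6 → R := fun i =>
  3 * x ⬝ᵥ x * x i - 12 * x i ^ 3 + 2 * ∑ j, x j ^ 3

theorem gauss_dotProduct (x : Fin 6 → R) {v : Fin 6 → R} (hv : ∑ i, v i = 0) :
    gauss x ⬝ᵥ v = polar₄ x x x v := by
  simp only [gauss, polar₄, dotProduct, Fin.sum_univ_six] at *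
  linear_combination (2 * (x 0 ^ 3 + x 1 ^ 3 + x 2 ^ 3 + x 3 ^ 3 + x 4 ^ 3 + x 5 ^ 3)) * hv

theorem sum_gauss {x : Fin 6 → R} (hx : ∑ i, x i = 0) : ∑ i, gauss x i = 0 := by
  simp only [gauss, dotProduct, Fin.sum_univ_six] at *
  linear_combination 3 * (x 0 ^ 2 + x 1 ^ 2 + x 2 ^ 2 + x 3 ^ 2 + x 4 ^ 2 + x 5 ^ 2) * hx

/-- The projection of `6 αβ` to the hyperplane of vectors with coordinate sum zero. -/
def segreProd (α β : Fin 6 → R) : Fin 6 → R := fun i => 6 * (α i * β i) - α ⬝ᵥ β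

theorem sum_segreProd (α β : Fin 6 → R) : ∑ i, segreProd α β i = 0 := by
  simp only [segreProd, dotProduct, Fin.sum_univ_six]
  ring

theorem segreProd_comp_perm (α β : Fin 6 → R) (σ : Equiv.Perm (Fin 6)) :
    segreProd (α ∘ σ) (β ∘ σ) = segreProd α β ∘ σ := by
  ext i
  simp only [segreProd, comp_equiv_dotProduct_comp_equiv, Function.comp_apply]

/-- The plane spanned by the squares `γγ` of the points `γ` of the line through `α` and `β`. -/
def segrePlane (α β : Fin 6 → R) : (Fin 3 → R) →ₗ[R] Fin 6 → R :=
  Fintype.linearCombination R ![segreProd α α, segreProd α β, segreProd β β]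

theorem segrePlane_apply (α β : Fin 6 → R) (c : Fin 3 → R) : segrePlane α β c =
    c 0 • segreProd α α + c 1 • segreProd α β + c 2 • segreProd β β := by
  simp [segrePlane, Fintype.linearCombination_apply, Fin.sum_univ_three]

theorem segreProd_smul_add_smul_self (α β : Fin 6 → R) (p q : R) :
    segreProd (p • α + q • β) (p • α + q • β) = segrePlane α β ![p ^ 2, 2 * p * q, q ^ 2] := by
  ext i
  simp only [segrePlane_apply, segreProd, dotProduct, Fin.sum_univ_six, Pi.add_apply,
    Pi.smul_apply, smul_eq_mul, Matrix.cons_val]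
  ring

theorem dotProduct_segrePlane {δ : Fin 6 → R} (hδ : ∑ i, δ i = 0) (α β : Fin 6 → R)
    (c : Fin 3 → R) : δ ⬝ᵥ segrePlane α β c =
      6 * ∑ i, δ i * (c 0 * α i ^ 2 + c 1 * (α i * β i) + c 2 * β i ^ 2) := by
  have hexpand (i : Fin 6) : δ i * segrePlane α β c i =
      6 * (δ i * (c 0 * α i ^ 2 + c 1 * (α i * β i) + c 2 * β i ^ 2)) -
        δ i * (c 0 * α ⬝ᵥ α + c 1 * α ⬝ᵥ β + c 2 * β ⬝ᵥ β) := by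
    simp only [segrePlane_apply, segreProd, Pi.add_apply, Pi.smul_apply, smul_eq_mul]
    ring
  change ∑ i, δ i * segrePlane α β c i = _
  simp only [hexpand, Finset.sum_sub_distrib, ← Finset.mul_sum, ← Finset.sum_mul, hδ, zero_mul,
    sub_zero]

/-- The second factor on the right is the resolvent cubic of the quartic with roots `c`, `d`, `e`,
`f`, evaluated at `a b`. -/
theorem prod_triple_sums {a b c d e f m n s₂ s₃ s₄ : R} (hm : m = a + b)
    (hm' : m = -(c + d + e + f)) (hn : n = a * b) (hs₂ : s₂ = c * d + (c + d) * (e + f) + e * f)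
    (hs₃ : s₃ = c * d * (e + f) + (c + d) * e * f) (hs₄ : s₄ = c * d * e * f) :
    (a + b + c) * (a + b + d) * (a + b + e) * (a + b + f) * (((a + c + d) * (a + e + f)) *
      ((a + c + e) * (a + d + f)) * ((a + c + f) * (a + d + e))) =
    (s₂ * m ^ 2 + s₃ * m + s₄) * (-n ^ 3 + 2 * s₂ * n ^ 2 - (s₂ ^ 2 - m * s₃ - 4 * s₄) * n -
      m * s₂ * s₃ - m ^ 2 * s₄ - s₃ ^ 2) := by
  have hquartic : (a + b + c) * (a + b + d) * (a + b + e) * (a + b + f) =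
      s₂ * m ^ 2 + s₃ * m + s₄ := by
    rw [← hm, hm', hs₂, hs₃, hs₄]; ring
  have hcd : (a + c + d) * (a + e + f) = (c + d) * (e + f) - n := by
    linear_combination a * hm' - a * hm + hn
  have hce : (a + c + e) * (a + d + f) = (c + e) * (d + f) - n := by
    linear_combination a * hm' - a * hm + hn
  have hcf : (a + c + f) * (a + d + e) = (c + f) * (d + e) - n := by
    linear_combination a * hm' - a * hm + hn
  rw [hquartic, hcd, hce, hcf]
  congr 1
  rw [hm', hs₂, hs₃, hs₄]
  ring

/-- The identities between the elementary symmetric functions `eₘ` of six elements with sum zero on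
which the geometry of `I₄` rests; the last one concerns the ten hyperplanes of `exceptional`. -/
theorem exists_sextic {x : Fin 6 → R} (hx : ∑ i, x i = 0) : ∃ e₂ e₃ e₄ e₅ e₆ : R,
    (∀ i, x i ^ 6 + e₂ * x i ^ 4 - e₃ * x i ^ 3 + e₄ * x i ^ 2 - e₅ * x i + e₆ = 0) ∧
    (∀ i, ∏ j, (x i + x (i.succAbove j)) = e₅ + x i ^ 2 * e₃) ∧
    ∑ i, x i ^ 2 = -2 * e₂ ∧ ∑ i, x i ^ 3 = 3 * e₃ ∧ ∑ i, x i ^ 4 = 2 * e₂ ^ 2 - 4 * e₄ ∧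
    (x 0 + x 1 + x 2) * (x 0 + x 1 + x 3) * (x 0 + x 1 + x 4) * (x 0 + x 1 + x 5) *
      (((x 0 + x 2 + x 3) * (x 0 + x 4 + x 5)) * ((x 0 + x 2 + x 4) * (x 0 + x 3 + x 5)) *
        ((x 0 + x 2 + x 5) * (x 0 + x 3 + x 4))) =
      -e₅ ^ 2 + 4 * e₄ * e₆ - e₃ ^ 2 * e₄ + e₂ * e₃ * e₅ - e₂ ^ 2 * e₆ := by
  obtain ⟨a, b, c, d, e, rfl⟩ : ∃ a b c d e, x = ![a, b, c, d, e, -(a + b + c + d + e)] := by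
    refine ⟨x 0, x 1, x 2, x 3, x 4, funext fun i => ?_⟩
    fin_cases i <;> try rfl
    rw [Fin.sum_univ_six] at hx
    exact (neg_eq_of_add_eq_zero_right hx).symm
  set f := -(a + b + c + d + e)
  obtain ⟨m, hm⟩ : ∃ m, m = a + b := ⟨_, rfl⟩
  obtain ⟨n, hn⟩ : ∃ n, n = a * b := ⟨_, rfl⟩
  obtain ⟨s₂, hs₂⟩ : ∃ s₂, s₂ = c * d + (c + d) * (e + f) + e * f := ⟨_, rfl⟩
  obtain ⟨s₃, hs₃⟩ : ∃ s₃, s₃ = c * d * (e + f) + (c + d) * e * f := ⟨_, rfl⟩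
  obtain ⟨s₄, hs₄⟩ : ∃ s₄, s₄ = c * d * e * f := ⟨_, rfl⟩
  refine ⟨n - m ^ 2 + s₂, m * s₂ + s₃ - n * m, n * s₂ + m * s₃ + s₄, n * s₃ + m * s₄, n * s₄,
    fun i => ?_, fun i => ?_, ?_, ?_, ?_, ?_⟩
  · rw [hm, hn, hs₂, hs₃, hs₄]
    fin_cases i <;> (dsimp [f]; ring)
  · rw [hm, hn, hs₂, hs₃, hs₄]
    fin_cases i <;>
      (simp only [Fin.prod_univ_five, Fin.succAbove]; dsimp [f, Fin.lt_def]; norm_num; ring)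
  iterate 3
    · simp only [hm, hn, hs₂, hs₃, hs₄, Fin.sum_univ_six]
      dsimp [f]
      ring
  · refine (prod_triple_sums hm ?_ hn hs₂ hs₃ hs₄).trans (by ring)
    simp only [hm, f]
    ring

end Polarization

section SegreCubic

variable {R K : Type*} [CommRing R] [Field K]

/-- On the quartic, the square of the polarity is affine linear; its leading coefficient vanishes
only on the ten hyperplanes. -/
theorem exists_gauss_sq_eq {x : Fin 6 → R} (hx : ∑ i, x i = 0) (hq : polar₄ x x x x = 0) :
    ∃ D E : R, (∀ i, gauss x i ^ 2 = D * x i + E) ∧ D ^ 2 = -20736 *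
      ((x 0 + x 1 + x 2) * (x 0 + x 1 + x 3) * (x 0 + x 1 + x 4) * (x 0 + x 1 + x 5) *
        (((x 0 + x 2 + x 3) * (x 0 + x 4 + x 5)) * ((x 0 + x 2 + x 4) * (x 0 + x 3 + x 5)) *
          ((x 0 + x 2 + x 5) * (x 0 + x 3 + x 4)))) := by
  obtain ⟨e₂, e₃, e₄, e₅, e₆, hroot, -, h2, h3, h4, htriple⟩ := exists_sextic hx
  have hdot : x ⬝ᵥ x = -2 * e₂ := by simpa only [dotProduct, ← pow_two] using h2
  have hq' : 48 * e₄ - 12 * e₂ ^ 2 = 0 := by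
    have h4' : ∑ i, x i * x i * x i * x i = 2 * e₂ ^ 2 - 4 * e₄ := by
      rw [← h4]
      exact Finset.sum_congr rfl fun i _ => by ring
    rw [polar₄, h4', hdot] at hq
    linear_combination hq
  refine ⟨72 * (2 * e₅ - e₂ * e₃), 36 * e₃ ^ 2 - 144 * e₆, fun i => ?_, ?_⟩
  · rw [gauss, hdot, h3]
    linear_combination 144 * hroot i - 3 * x i ^ 2 * hq'
  · rw [htriple]
    linear_combination 432 * (4 * e₆ - e₃ ^ 2) * hq'

/-- The polarity maps the square of a point of the Segre cubic `∑ γⱼ = ∑ γⱼ³ = 0` to a multiple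
of that point, and to zero if two coordinates are opposite. -/
theorem exists_polar₄_segreProd_eq {γ : Fin 6 → R} (h1 : ∑ i, γ i = 0) (h3 : ∑ i, γ i ^ 3 = 0) :
    ∃ e : R, (∀ v, ∑ i, v i = 0 → polar₄ (segreProd γ γ) (segreProd γ γ) (segreProd γ γ) v =
      e * γ ⬝ᵥ v) ∧ ∀ i j, i ≠ j → γ i + γ j = 0 → e = 0 := by
  obtain ⟨e₂, e₃, e₄, e₅, e₆, hroot, hpairs, hp2, hp3, hp4, -⟩ := exists_sextic h1
  rw [h3] at hp3
  refine ⟨-2592 * e₅, fun v hv => ?_, fun i j hij h => ?_⟩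
  · have hdot : γ ⬝ᵥ γ = -2 * e₂ := by simpa only [dotProduct, ← pow_two] using hp2
    have hnorm : segreProd γ γ ⬝ᵥ segreProd γ γ = 48 * e₂ ^ 2 - 144 * e₄ := by
      unfold segreProd
      simp only [hdot]
      simp only [dotProduct, Fin.sum_univ_six] at hp2 hp4 ⊢
      linear_combination 36 * hp4 + 24 * e₂ * hp2
    obtain ⟨c, hc⟩ : ∃ c, gauss (segreProd γ γ) = (-2592 * e₅) • γ + fun _ => c := by
      refine ⟨192 * e₂ ^ 3 - 864 * e₂ * e₄ + 2592 * e₆ + 2 * ∑ j, segreProd γ γ j ^ 3,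
        funext fun i => ?_⟩
      simp only [gauss, hnorm, segreProd, hdot, Pi.add_apply, Pi.smul_apply, smul_eq_mul]
      linear_combination (-2592) * hroot i + 864 * γ i ^ 3 * hp3
    have hconst : (fun _ => c) ⬝ᵥ v = 0 := by rw [dotProduct, ← Finset.mul_sum, hv, mul_zero]
    rw [← gauss_dotProduct _ hv, hc, add_dotProduct, smul_dotProduct, hconst, add_zero,
      smul_eq_mul]
  · obtain ⟨j, rfl⟩ := Fin.exists_succAbove_eq hij.symm
    have hzero : ∏ j, (γ i + γ (i.succAbove j)) = 0 :=
      Finset.prod_eq_zero (Finset.mem_univ j) h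
    rw [hpairs] at hzero
    linear_combination (-2592) * hzero + (-864) * γ i ^ 2 * hp3

theorem exists_perm_fin_six {i j k : Fin 6} (hij : i ≠ j) (hik : i ≠ k) (hjk : j ≠ k) :
    ∃ σ : Equiv.Perm (Fin 6), σ 0 = i ∧ σ 1 = j ∧ σ 2 = k := by
  have hf : Function.Injective ![i, j, k] := by
    intro a b
    fin_cases a <;> fin_cases b <;> simp [hij, hik, hjk, hij.symm, hik.symm, hjk.symm]
  have hg : Function.Injective ![(0 : Fin 6), 1, 2] := by decide
  obtain ⟨σ, hσ⟩ := (Equiv.Perm.isMultiplyPretransitive (Fin 6) 3).exists_smul_eq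
    ⟨_, hg⟩ ⟨_, hf⟩
  exact ⟨σ, DFunLike.congr_fun hσ 0, DFunLike.congr_fun hσ 1, DFunLike.congr_fun hσ 2⟩

/-- The sum zero and the vanishing of the sum of cubes split the remaining four coordinates into two
opposite pairs. -/
theorem exists_perm_opposite_pairs (h3 : (3 : K) ≠ 0) {γ : Fin 6 → K} (hsum : ∑ i, γ i = 0)
    (hcube : ∑ i, γ i ^ 3 = 0) {i j k : Fin 6} (hij : i ≠ j) (hik : i ≠ k) (hjk : j ≠ k)
    (h : γ i + γ j = 0) : ∃ σ : Equiv.Perm (Fin 6), σ 0 = i ∧ σ 1 = j ∧ σ 2 = k ∧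
      γ (σ 2) + γ (σ 3) = 0 ∧ γ (σ 4) + γ (σ 5) = 0 := by
  obtain ⟨σ, rfl, rfl, rfl⟩ := exists_perm_fin_six hij hik hjk
  rw [← Equiv.sum_comp σ, Fin.sum_univ_six] at hsum hcube
  have hrest : γ (σ 5) = -(γ (σ 2) + γ (σ 3) + γ (σ 4)) := by linear_combination hsum - h
  have hprod : 3 * ((γ (σ 2) + γ (σ 3)) * ((γ (σ 2) + γ (σ 4)) * (γ (σ 3) + γ (σ 4)))) = 0 := by
    rw [hrest] at hcube
    linear_combination
      (γ (σ 0) ^ 2 - γ (σ 0) * γ (σ 1) + γ (σ 1) ^ 2) * h - hcube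
  simp only [mul_eq_zero, h3, false_or] at hprod
  rcases hprod with h23 | h24 | h34
  · exact ⟨σ, rfl, rfl, rfl, h23, by linear_combination hrest - h23⟩
  · refine ⟨Equiv.swap 3 4 |>.trans σ, rfl, rfl, rfl, h24, ?_⟩
    change γ (σ 3) + γ (σ 5) = 0
    linear_combination hrest - h24
  · refine ⟨Equiv.swap 3 5 |>.trans σ, rfl, rfl, rfl, ?_, ?_⟩
    · change γ (σ 2) + γ (σ 5) = 0
      linear_combination hrest - h34
    · change γ (σ 4) + γ (σ 3) = 0
      linear_combination h34

theorem exists_ne_and_ne (i j : Fin 6) : ∃ k, i ≠ k ∧ j ≠ k := by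
  decide +revert

theorem mem_span_range_of_forall_dotProduct {ι m : Type*} [Fintype ι] [Finite m] {f : m → ι → K}
    {l : ι → K} (h : ∀ v, (∀ j, f j ⬝ᵥ v = 0) → l ⬝ᵥ v = 0) :
    l ∈ Submodule.span K (Set.range f) := by
  classical
  have hl := mem_span_of_iInf_ker_le_ker (L := fun j => dotProductEquiv K ι (f j))
    (K := dotProductEquiv K ι l) fun v hv => h v fun j => (Submodule.mem_iInf _).1 hv j
  rw [Set.range_comp' (dotProductEquiv K ι) f, ← LinearEquiv.coe_coe, Submodule.span_image] at hl
  simpa using hl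

theorem eq_zero_of_forall_dotProduct (h2 : (2 : K) ≠ 0) (h3 : (3 : K) ≠ 0) {l : Fin 6 → K}
    (hl : ∑ i, l i = 0) (h : ∀ v, ∑ i, v i = 0 → l ⬝ᵥ v = 0) : l = 0 := by
  have hconst (i : Fin 6) : l i = l 0 := by
    have hi := h (Pi.single i 1 - Pi.single 0 1) (by simp)
    rwa [dotProduct_sub, dotProduct_single_one, dotProduct_single_one, sub_eq_zero] at hi
  simp only [hconst, Finset.sum_const, Finset.card_univ, Fintype.card_fin] at hl
  have h0 : 2 * 3 * l 0 = 0 := by linear_combination hl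
  ext i
  simpa [hconst i, h2, h3] using h0

theorem coeff_eq_zero_of_forall_eval [Infinite K] {d : ℕ} (a : Fin d → K)
    (ha : ∀ t, ∑ i : Fin d, a i * t ^ (i : ℕ) = 0) (i : Fin d) : a i = 0 := by
  have hpoly : ∑ i : Fin d, Polynomial.monomial (i : ℕ) (a i) = 0 := Polynomial.funext fun t => by
    simpa [Polynomial.eval_finsetSum] using ha t
  simpa [Polynomial.finsetSum_coeff, Polynomial.coeff_monomial, Fin.val_inj] using
    congrArg (Polynomial.coeff · i) hpoly

theorem polar₄_cube_coeff [Infinite K] (h2 : (2 : K) ≠ 0) (h3 : (3 : K) ≠ 0) {u v w z : Fin 6 → K}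
    (hz : ∀ t : K, polar₄ (u + (2 * t) • v + t ^ 2 • w) (u + (2 * t) • v + t ^ 2 • w)
      (u + (2 * t) • v + t ^ 2 • w) z = 0) :
    polar₄ u u u z = 0 ∧ polar₄ u u v z = 0 ∧ polar₄ u u w z + 4 * polar₄ u v v z = 0 ∧
      3 * polar₄ u v w z + 2 * polar₄ v v v z = 0 ∧ polar₄ u w w z + 4 * polar₄ v v w z = 0 ∧
      polar₄ v w w z = 0 ∧ polar₄ w w w z = 0 := by
  have hcoeff := coeff_eq_zero_of_forall_eval ![polar₄ u u u z, 2 * 3 * polar₄ u u v z,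
    3 * (polar₄ u u w z + 4 * polar₄ u v v z), 2 * 2 * (3 * polar₄ u v w z + 2 * polar₄ v v v z),
    3 * (polar₄ u w w z + 4 * polar₄ v v w z), 2 * 3 * polar₄ v w w z, polar₄ w w w z] fun t => by
      have ht := hz t
      simp only [polar₄_add₁, polar₄_add₂, polar₄_add₃, polar₄_smul₁, polar₄_smul₂,
        polar₄_smul₃] at ht
      simp only [polar₄_swap₁₂ v u, polar₄_swap₁₂ w u, polar₄_swap₁₂ w v, polar₄_swap₂₃ _ v u,
        polar₄_swap₂₃ _ w u, polar₄_swap₂₃ _ w v] at ht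
      simp only [Fin.sum_univ_seven, Matrix.cons_val, Fin.coe_ofNat_eq_mod]
      linear_combination ht
  simpa [Fin.forall_fin_succ, h2, h3] using hcoeff

/-- Half of the polar form of the discriminant `c₁² - 4c₀c₂`, which vanishes at the squares. -/
def discPairing (c d : Fin 3 → K) : K := c 1 * d 1 - 2 * (c 0 * d 2 + c 2 * d 0)

/-- A point of the quartic, outside the ten hyperplanes `xᵢ + xⱼ + xₖ = 0`. -/
structure IsGeneralPoint (x : Fin 6 → K) : Prop where
  sum_eq : ∑ i, x i = 0
  polar₄_eq : polar₄ x x x x = 0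
  triple_ne : ∀ i j k, i ≠ j → i ≠ k → j ≠ k → x i + x j + x k ≠ 0

namespace IsGeneralPoint

variable {x : Fin 6 → K} (hx : IsGeneralPoint x)
include hx

theorem ne_zero : x ≠ 0 := fun h0 =>
  hx.triple_ne 0 1 2 (by decide) (by decide) (by decide) (by simp [h0])

theorem exists_gauss_sq_eq_of_ne (h2 : (2 : K) ≠ 0) (h3 : (3 : K) ≠ 0) :
    ∃ D E : K, D ≠ 0 ∧ ∀ i, gauss x i ^ 2 = D * x i + E := by
  obtain ⟨D, E, hsq, hD⟩ := exists_gauss_sq_eq hx.sum_eq hx.polar₄_eq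
  refine ⟨D, E, ne_zero_pow two_ne_zero ?_, hsq⟩
  have hconst : (-20736 : K) ≠ 0 := by
    rw [show (-20736 : K) = -(2 ^ 8 * 3 ^ 4) by norm_num]
    exact neg_ne_zero.2 (mul_ne_zero (pow_ne_zero 8 h2) (pow_ne_zero 4 h3))
  simp only [hD, ne_eq, mul_eq_zero, hconst, false_or, not_or]
  refine ⟨⟨⟨⟨?_, ?_⟩, ?_⟩, ?_⟩, ⟨⟨?_, ?_⟩, ?_, ?_⟩, ?_, ?_⟩ <;>
    exact hx.triple_ne _ _ _ (by decide) (by decide) (by decide)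

theorem exists_segreProd_gauss_eq (h2 : (2 : K) ≠ 0) (h3 : (3 : K) ≠ 0) :
    ∃ D : K, D ≠ 0 ∧ segreProd (gauss x) (gauss x) = D • x := by
  obtain ⟨D, E, hD, hsq⟩ := hx.exists_gauss_sq_eq_of_ne h2 h3
  refine ⟨2 * 3 * D, mul_ne_zero (mul_ne_zero h2 h3) hD, funext fun i => ?_⟩
  have hnorm : gauss x ⬝ᵥ gauss x = 6 * E := by
    have hsum : ∑ i, gauss x i ^ 2 = D * ∑ i, x i + 6 * E := by
      simp only [hsq, Fin.sum_univ_six]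
      ring
    simpa only [dotProduct, ← pow_two, hx.sum_eq, mul_zero, zero_add] using hsum
  rw [segreProd, hnorm, ← pow_two, hsq, Pi.smul_apply, smul_eq_mul]
  ring

theorem sum_gauss_sq_mul_eq_zero (h2 : (2 : K) ≠ 0) (h3 : (3 : K) ≠ 0) {v : Fin 6 → K}
    (hv : ∑ i, v i = 0) (hxv : x ⬝ᵥ v = 0) : ∑ i, gauss x i ^ 2 * v i = 0 := by
  obtain ⟨D, E, -, hsq⟩ := hx.exists_gauss_sq_eq_of_ne h2 h3
  have hsum : ∑ i, gauss x i ^ 2 * v i = D * x ⬝ᵥ v + E * ∑ i, v i := by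
    simp only [hsq, dotProduct, Fin.sum_univ_six]
    ring
  rw [hsum, hxv, hv, mul_zero, mul_zero, add_zero]

theorem sum_gauss_cube (h2 : (2 : K) ≠ 0) (h3 : (3 : K) ≠ 0) : ∑ i, gauss x i ^ 3 = 0 := by
  simpa only [← pow_succ] using hx.sum_gauss_sq_mul_eq_zero h2 h3 (sum_gauss hx.sum_eq) (by
    rw [dotProduct_comm, gauss_dotProduct x hx.sum_eq, hx.polar₄_eq])

theorem gauss_ne_zero (h2 : (2 : K) ≠ 0) (h3 : (3 : K) ≠ 0) : gauss x ≠ 0 := fun h0 => by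
  obtain ⟨D, hD, hsq⟩ := hx.exists_segreProd_gauss_eq h2 h3
  refine hx.ne_zero ((smul_eq_zero.1 (hsq.symm.trans ?_)).resolve_left hD)
  ext i
  simp [h0, segreProd]

theorem gauss_add_gauss_ne_zero (h2 : (2 : K) ≠ 0) (h3 : (3 : K) ≠ 0) (i j : Fin 6)
    (hij : i ≠ j) : gauss x i + gauss x j ≠ 0 := fun hadd => by
  obtain ⟨D, hD, hsq⟩ := hx.exists_segreProd_gauss_eq h2 h3
  obtain ⟨e, he, hzero⟩ :=
    exists_polar₄_segreProd_eq (sum_gauss hx.sum_eq) (hx.sum_gauss_cube h2 h3)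
  have hperp (v : Fin 6 → K) (hv : ∑ i, v i = 0) : gauss x ⬝ᵥ v = 0 := by
    have hv' := he v hv
    rw [hsq, hzero i j hij hadd, zero_mul, polar₄_smul₁, polar₄_smul₂, polar₄_smul₃,
      ← gauss_dotProduct x hv] at hv'
    simpa only [mul_eq_zero, hD, false_or] using hv'
  exact hx.gauss_ne_zero h2 h3 (eq_zero_of_forall_dotProduct h2 h3 (sum_gauss hx.sum_eq) hperp)

end IsGeneralPoint

theorem polar₄_pairs {a b c : R} (habc : a + b + c = 0) {v w : Fin 6 → R} (hv : ∑ i, v i = 0)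
    (hw : ∑ i, w i = 0) : polar₄ ![a, a, b, b, c, c] ![a, a, b, b, c, c] v w =
      ((2 * (a - b) * (c - a) * (v 0 - v 1)) • ![1, -1, 0, 0, 0, 0] +
        (2 * (b - c) * (a - b) * (v 2 - v 3)) • ![0, 0, 1, -1, 0, 0] +
        (2 * (c - a) * (b - c) * (v 4 - v 5)) • ![0, 0, 0, 0, 1, -1]) ⬝ᵥ w := by
  obtain rfl : c = -(a + b) := by linear_combination habc
  simp only [Fin.sum_univ_six] at hv hw
  have hv' : v 5 = -(v 0 + v 1 + v 2 + v 3 + v 4) := by linear_combination hv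
  have hw' : w 5 = -(w 0 + w 1 + w 2 + w 3 + w 4) := by linear_combination hw
  simp only [polar₄, dotProduct, Fin.sum_univ_six, Pi.add_apply, Pi.smul_apply, smul_eq_mul,
    Matrix.cons_val]
  rw [hv', hw']
  ring

theorem eq_zero_of_forall_dotProduct_pair (h2 : (2 : K) ≠ 0) (h3 : (3 : K) ≠ 0)
    {f l : Fin 6 → K} (hf : ∑ i, f i = 0) (hf01 : f 0 + f 1 ≠ 0) (hl : ∑ i, l i = 0)
    (hl01 : l 0 + l 1 = 0) (h : ∀ w, ∑ i, w i = 0 → f ⬝ᵥ w = 0 → l ⬝ᵥ w = 0) : l = 0 := by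
  have hspan : l ∈ Submodule.span K (Set.range ![1, f]) :=
    mem_span_range_of_forall_dotProduct fun w hw =>
      h w ((one_dotProduct w).symm.trans (hw 0)) (hw 1)
  obtain ⟨k, rfl⟩ := Submodule.mem_span_range_iff_exists_fun K |>.1 hspan
  simp only [Fin.sum_univ_two, Fin.sum_univ_six, Matrix.cons_val, Pi.add_apply, Pi.smul_apply,
    Pi.one_apply, smul_eq_mul] at hf hl hl01
  have hk0 : 2 * 3 * k 0 = 0 := by linear_combination hl - k 1 * hf
  simp only [mul_eq_zero, h2, h3, false_or] at hk0
  have hk1 : k 1 * (f 0 + f 1) = 0 := by linear_combination hl01 - 2 * hk0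
  simp [hk0, (mul_eq_zero.1 hk1).resolve_right hf01]

theorem eq_of_polar₄_pairs_eq_zero (h2 : (2 : K) ≠ 0) (h3 : (3 : K) ≠ 0)
    {a b c : K} (habc : a + b + c = 0) (hab : a ≠ b) (hbc : b ≠ c) (hca : c ≠ a) {f : Fin 6 → K}
    (hf : ∑ i, f i = 0) (hf01 : f 0 + f 1 ≠ 0) {v : Fin 6 → K} (hv : ∑ i, v i = 0)
    (hker : ∀ w, ∑ i, w i = 0 → f ⬝ᵥ w = 0 →
      polar₄ ![a, a, b, b, c, c] ![a, a, b, b, c, c] v w = 0) :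
    v 0 = v 1 ∧ v 2 = v 3 ∧ v 4 = v 5 := by
  have hl := eq_zero_of_forall_dotProduct_pair h2 h3 hf hf01 ?_ ?_ fun w hw hfw =>
    (polar₄_pairs habc hv hw).symm.trans (hker w hw hfw)
  · have h0 := congrFun hl 0
    have h2' := congrFun hl 2
    have h4 := congrFun hl 4
    simp only [Pi.add_apply, Pi.smul_apply, Matrix.cons_val, smul_eq_mul, mul_one, mul_zero,
      add_zero, zero_add, Pi.zero_apply, mul_eq_zero, h2, sub_ne_zero.2 hab, sub_ne_zero.2 hbc,
      sub_ne_zero.2 hca, false_or, sub_eq_zero] at h0 h2' h4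
    exact ⟨h0, h2', h4⟩
  all_goals
    simp only [Fin.sum_univ_six, Pi.add_apply, Pi.smul_apply, Matrix.cons_val, smul_eq_mul]
    ring

theorem exists_eq_smul_of_polar₄_pairs_eq_zero (h2 : (2 : K) ≠ 0) (h3 : (3 : K) ≠ 0)
    {a b c : K} (habc : a + b + c = 0) (hab : a ≠ b) (hbc : b ≠ c) (hca : c ≠ a) {f : Fin 6 → K}
    (hf : ∑ i, f i = 0) (hf01 : f 0 + f 1 ≠ 0) (hfp : f ⬝ᵥ ![a, a, b, b, c, c] = 0) {v : Fin 6 → K}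
    (hv : ∑ i, v i = 0) (hfv : f ⬝ᵥ v = 0) (hker : ∀ w, ∑ i, w i = 0 → f ⬝ᵥ w = 0 →
      polar₄ ![a, a, b, b, c, c] ![a, a, b, b, c, c] v w = 0) :
    ∃ r : K, v = r • ![a, a, b, b, c, c] := by
  obtain ⟨h01, h23, h45⟩ := eq_of_polar₄_pairs_eq_zero h2 h3 habc hab hbc hca hf hf01 hv hker
  simp only [dotProduct, Fin.sum_univ_six, Matrix.cons_val, ← h01, ← h23, ← h45] at hf hv hfp hfv
  have hsum : v 0 + v 2 + v 4 = 0 :=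
    (mul_eq_zero.1 (show 2 * (v 0 + v 2 + v 4) = 0 by linear_combination hv)).resolve_left h2
  have hdet : (v 0 - v 4) * (b - c) - (v 2 - v 4) * (a - c) = 0 := by
    refine (mul_eq_zero.1 (show (f 0 + f 1) * _ = 0 from ?_)).resolve_left hf01
    linear_combination (b - c) * hfv - (v 2 - v 4) * hfp + (b * -v 4 + c * v 2) * hf
  have hca' : a - c ≠ 0 := sub_ne_zero.2 hca.symm
  obtain ⟨r, hr⟩ : ∃ r, v 0 - v 4 = r * (a - c) := ⟨(v 0 - v 4) / (a - c), by field_simp⟩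
  have h24 : v 2 - v 4 = r * (b - c) := mul_left_cancel₀ hca' (by
    linear_combination (b - c) * hr - hdet)
  have hv4 : v 4 = r * c := mul_left_cancel₀ h3 (by linear_combination hsum - hr - h24 - r * habc)
  refine ⟨r, funext fun i => ?_⟩
  have hv0 : v 0 = r * a := by linear_combination hr + hv4
  have hv2 : v 2 = r * b := by linear_combination h24 + hv4
  fin_cases i <;> simp [← h01, ← h23, ← h45, hv0, hv2, hv4]

theorem exists_segreProd_eq_pairs (h2 : (2 : K) ≠ 0) (h3 : (3 : K) ≠ 0) {γ : Fin 6 → K}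
    (h01 : γ 0 + γ 1 = 0) (h23 : γ 2 + γ 3 = 0) (h45 : γ 4 + γ 5 = 0)
    (hopp : ∀ i j k, i ≠ j → i ≠ k → j ≠ k → γ i + γ j = 0 → γ i + γ k ≠ 0) :
    ∃ a b c, segreProd γ γ = ![a, a, b, b, c, c] ∧ a + b + c = 0 ∧ a ≠ b ∧ b ≠ c ∧ c ≠ a := by
  have hpair {i j : Fin 6} (hij : γ i + γ j = 0) : segreProd γ γ j = segreProd γ γ i := by
    simp only [segreProd]
    linear_combination 6 * (γ j - γ i) * hij
  have hne {i j k : Fin 6} (hij : i ≠ j) (hik : i ≠ k) (hjk : j ≠ k) (hadd : γ i + γ j = 0) :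
      segreProd γ γ i ≠ segreProd γ γ k := fun heq => by
    have hprod : 2 * 3 * ((γ i + γ k) * (γ j + γ k)) = 0 := by
      simp only [segreProd] at heq
      linear_combination 6 * (γ i + γ k) * hadd - heq
    simp only [mul_eq_zero, h2, h3, false_or] at hprod
    exact hprod.elim (hopp i j k hij hik hjk hadd)
      (hopp j i k hij.symm hjk hik (by rwa [add_comm]))
  refine ⟨segreProd γ γ 0, segreProd γ γ 2, segreProd γ γ 4, funext fun i => ?_, ?_,
    hne (j := 1) (by decide) (by decide) (by decide) h01,
    hne (j := 3) (by decide) (by decide) (by decide) h23,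
    hne (j := 5) (by decide) (by decide) (by decide) h45⟩
  · fin_cases i <;> first | rfl | exact hpair ‹_›
  · have hsum := sum_segreProd γ γ
    rw [Fin.sum_univ_six, hpair h01, hpair h23, hpair h45] at hsum
    refine (mul_eq_zero.1 (show (2 : K) * _ = 0 from ?_)).resolve_left h2
    linear_combination hsum

theorem segrePlane_single_zero (α β : Fin 6 → R) : segrePlane α β ![1, 0, 0] = segreProd α α := by
  simp [segrePlane_apply]

theorem segrePlane_single_two (α β : Fin 6 → R) : segrePlane α β ![0, 0, 1] = segreProd β β := by
  simp [segrePlane_apply]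

/-- The point of the line through `α` and `β` whose coordinates with indices `0` and `j + 1` are
opposite. -/
def oppositePoint (α β : Fin 6 → R) (j : Fin 5) : Fin 6 → R :=
  (β 0 + β j.succ) • α + (-(α 0 + α j.succ)) • β

theorem oppositePoint_add (α β : Fin 6 → R) (j : Fin 5) :
    oppositePoint α β j 0 + oppositePoint α β j j.succ = 0 := by
  simp only [oppositePoint, Pi.add_apply, Pi.smul_apply, smul_eq_mul]
  ring

/-- The polar form of the conic in the plane of `x`, `y` which is tangent to `T_x` and `T_y` and
squares to the quartic form, where `x` and `y` are points of the quartic with `P(x, y) = 0` and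
`P(y, x) = 0`. -/
def polarConic (x y z w : Fin 6 → R) : R :=
  2 * polar₄ x x y y * polar₄ x y z w - polar₄ x x y z * polar₄ y y x w -
    polar₄ x x y w * polar₄ y y x z

theorem polarConic_smul_smul (x y z w : Fin 6 → R) (r s : R) :
    polarConic (r • x) (s • y) z w = r ^ 3 * s ^ 3 * polarConic x y z w := by
  simp only [polarConic, polar₄_smul₁, polar₄_smul₂, polar₄_smul₃, polar₄_smul₄]
  ring

/-- `α` and `β` span a line on the Segre cubic `∑ xⱼ = ∑ xⱼ³ = 0`, neither of them is on one of the
fifteen planes `xᵢ + xⱼ = xₖ + xₗ = xₘ + xₙ = 0` of the cubic, and the square of `α` is on none of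
the ten hyperplanes `xᵢ + xⱼ + xₖ = 0`. -/
structure IsSegreLine (α β : Fin 6 → K) : Prop where
  sum_left : ∑ i, α i = 0
  sum_right : ∑ i, β i = 0
  cube_left : ∑ i, α i ^ 3 = 0
  sq_left : ∑ i, α i ^ 2 * β i = 0
  sq_right : ∑ i, α i * β i ^ 2 = 0
  cube_right : ∑ i, β i ^ 3 = 0
  linearIndependent : LinearIndependent K ![α, β]
  pair_left : ∀ i j, i ≠ j → α i + α j ≠ 0
  pair_right : ∀ i j, i ≠ j → β i + β j ≠ 0
  triple_left : ∀ i j k, i ≠ j → i ≠ k → j ≠ k →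
    segreProd α α i + segreProd α α j + segreProd α α k ≠ 0

namespace IsSegreLine

variable {α β : Fin 6 → K} (h : IsSegreLine α β)
include h

theorem eq_zero_of_smul_add_smul_eq_zero {p q : K} (hpq : p • α + q • β = 0) : p = 0 ∧ q = 0 :=
  LinearIndependent.pair_iff.1 h.linearIndependent p q hpq

theorem comp_perm (σ : Equiv.Perm (Fin 6)) : IsSegreLine (α ∘ σ) (β ∘ σ) where
  sum_left := (Equiv.sum_comp σ α).trans h.sum_left
  sum_right := (Equiv.sum_comp σ β).trans h.sum_right
  cube_left := (Equiv.sum_comp σ fun i => α i ^ 3).trans h.cube_left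
  sq_left := (Equiv.sum_comp σ fun i => α i ^ 2 * β i).trans h.sq_left
  sq_right := (Equiv.sum_comp σ fun i => α i * β i ^ 2).trans h.sq_right
  cube_right := (Equiv.sum_comp σ fun i => β i ^ 3).trans h.cube_right
  linearIndependent := LinearIndependent.pair_iff.2 fun p q hpq =>
    h.eq_zero_of_smul_add_smul_eq_zero <| funext fun i => by
      simpa using congrFun hpq (σ.symm i)
  pair_left i j hij := h.pair_left _ _ (σ.injective.ne hij)
  pair_right i j hij := h.pair_right _ _ (σ.injective.ne hij)
  triple_left i j k hij hik hjk := by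
    simpa only [segreProd_comp_perm, Function.comp_apply] using
      h.triple_left _ _ _ (σ.injective.ne hij) (σ.injective.ne hik) (σ.injective.ne hjk)

variable (p q : K)

theorem sum_smul_add_smul : ∑ i, (p • α + q • β) i = 0 := by
  simp only [Pi.add_apply, Pi.smul_apply, Finset.sum_add_distrib, ← Finset.smul_sum, h.sum_left,
    h.sum_right, smul_zero, add_zero]

theorem sum_smul_add_smul_cube : ∑ i, (p • α + q • β) i ^ 3 = 0 := by
  have h1 := h.cube_left
  have h2 := h.sq_left
  have h3 := h.sq_right
  have h4 := h.cube_right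
  simp only [Fin.sum_univ_six, Pi.add_apply, Pi.smul_apply, smul_eq_mul] at *
  linear_combination p ^ 3 * h1 + 3 * p ^ 2 * q * h2 + 3 * p * q ^ 2 * h3 + q ^ 3 * h4

theorem sum_smul_add_smul_sq_mul_left : ∑ i, (p • α + q • β) i ^ 2 * α i = 0 := by
  have h1 := h.cube_left
  have h2 := h.sq_left
  have h3 := h.sq_right
  simp only [Fin.sum_univ_six, Pi.add_apply, Pi.smul_apply, smul_eq_mul] at *
  linear_combination p ^ 2 * h1 + 2 * p * q * h2 + q ^ 2 * h3

theorem sum_smul_add_smul_mul_left_sq : ∑ i, (p • α + q • β) i * α i ^ 2 = 0 := by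
  have h1 := h.cube_left
  have h2 := h.sq_left
  simp only [Fin.sum_univ_six, Pi.add_apply, Pi.smul_apply, smul_eq_mul] at *
  linear_combination p * h1 + q * h2

variable {p q}

theorem eq_zero_of_eq_vec {s u : K} (hγ : p • α + q • β = ![s, -s, -s, s, u, -u]) :
    s = 0 ∧ u = 0 := by
  have hα := h.sum_left
  have hquad := h.sum_smul_add_smul_sq_mul_left p q
  have hlin := h.sum_smul_add_smul_mul_left_sq p q
  have htriple := h.triple_left
  rw [hγ] at hquad hlin
  simp only [segreProd, dotProduct, Fin.sum_univ_six] at hα hquad hlin htriple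
  dsimp at hquad hlin
  have hsq : (u - s) * (u + s) = 0 :=
    (mul_eq_zero.1 (show _ * (α 4 + α 5) = 0 by
      linear_combination hquad - s ^ 2 * hα)).resolve_right (h.pair_left 4 5 (by decide))
  have hs : s = 0 := by
    rcases mul_eq_zero.1 hsq with hu | hu
    · refine (mul_eq_zero.1 ?_).resolve_right (htriple 0 3 4 (by decide) (by decide) (by decide))
      linear_combination 3 * hlin - 3 * (α 4 ^ 2 - α 5 ^ 2) * hu
    · refine (mul_eq_zero.1 ?_).resolve_right (htriple 0 3 5 (by decide) (by decide) (by decide))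
      linear_combination 3 * hlin - 3 * (α 4 ^ 2 - α 5 ^ 2) * hu
  exact ⟨hs, by simpa [hs] using hsq⟩

/-- After a permutation, the coordinates of such a point are `(s, -s, -s, s, u, -u)`. -/
theorem eq_zero_of_add_eq_zero (h3 : (3 : K) ≠ 0) {i j k : Fin 6} (hij : i ≠ j) (hik : i ≠ k)
    (hjk : j ≠ k) (h₁ : (p • α + q • β) i + (p • α + q • β) j = 0)
    (h₂ : (p • α + q • β) i + (p • α + q • β) k = 0) : p = 0 ∧ q = 0 := by
  obtain ⟨σ, rfl, rfl, rfl, h23, h45⟩ := exists_perm_opposite_pairs h3 (h.sum_smul_add_smul p q)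
    (h.sum_smul_add_smul_cube p q) hij hik hjk h₁
  have hγ : p • (α ∘ σ) + q • (β ∘ σ) = ![(p • α + q • β) (σ 0), -(p • α + q • β) (σ 0),
      -(p • α + q • β) (σ 0), (p • α + q • β) (σ 0), (p • α + q • β) (σ 4),
      -(p • α + q • β) (σ 4)] := by
    change (p • α + q • β) ∘ σ = _
    generalize p • α + q • β = γ at *
    ext i
    fin_cases i
    · rfl
    · change γ (σ 1) = -γ (σ 0); linear_combination h₁
    · change γ (σ 2) = -γ (σ 0); linear_combination h₂
    · change γ (σ 3) = γ (σ 0); linear_combination h23 - h₂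
    · rfl
    · change γ (σ 5) = -γ (σ 4); linear_combination h45
  obtain ⟨h0, h4⟩ := (h.comp_perm σ).eq_zero_of_eq_vec hγ
  refine (h.comp_perm σ).eq_zero_of_smul_add_smul_eq_zero (hγ.trans ?_)
  rw [h0, h4]
  ext i
  fin_cases i <;> simp

theorem eq_zero_of_pairwise_eq (h2 : (2 : K) ≠ 0) (h3 : (3 : K) ≠ 0)
    (h01 : (p • α + q • β) 0 = (p • α + q • β) 1) (h23 : (p • α + q • β) 2 = (p • α + q • β) 3)
    (h45 : (p • α + q • β) 4 = (p • α + q • β) 5) : p = 0 ∧ q = 0 := by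
  have hsum := h.sum_smul_add_smul p q
  have hcube := h.sum_smul_add_smul_cube p q
  have hopp {i j k : Fin 6} :=
    h.eq_zero_of_add_eq_zero (p := p) (q := q) (i := i) (j := j) (k := k) h3
  generalize p • α + q • β = γ at *
  rw [Fin.sum_univ_six, ← h01, ← h23, ← h45] at hsum hcube
  have hsum' : γ 0 + γ 2 + γ 4 = 0 :=
    (mul_eq_zero.1 (show 2 * (γ 0 + γ 2 + γ 4) = 0 by linear_combination hsum)).resolve_left h2
  have hprod : 2 * 3 * (γ 0 * γ 2 * γ 4) = 0 := by
    obtain hγ : γ 4 = -(γ 0 + γ 2) := by linear_combination hsum'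
    rw [hγ] at hcube ⊢
    linear_combination hcube
  simp only [mul_eq_zero, h2, h3, or_self, false_or] at hprod
  rcases hprod with (hγ0 | hγ2) | hγ4
  · exact hopp (i := 2) (j := 4) (k := 5) (by decide) (by decide) (by decide)
      (by linear_combination hsum' - hγ0)
      (by linear_combination hsum' - hγ0 - h45)
  · exact hopp (i := 0) (j := 4) (k := 5) (by decide) (by decide) (by decide)
      (by linear_combination hsum' - hγ2)
      (by linear_combination hsum' - hγ2 - h45)
  · exact hopp (i := 0) (j := 2) (k := 3) (by decide) (by decide) (by decide)
      (by linear_combination hsum' - hγ4)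
      (by linear_combination hsum' - hγ4 - h23)

theorem add_mul_eq_of_quadratic_const (h2 : (2 : K) ≠ 0) (h3 : (3 : K) ≠ 0) {a b c n : K}
    (hconst : ∀ i, a * α i ^ 2 + b * (α i * β i) + c * β i ^ 2 = n) {i j : Fin 6} (hij : i ≠ j) :
    2 * a * (α i + α j) + b * (β i + β j) = 0 ∧ b * (α i + α j) + 2 * c * (β i + β j) = 0 := by
  obtain ⟨k, hik, hjk⟩ := exists_ne_and_ne i j
  obtain ⟨σ, rfl, rfl, -, h23, h45⟩ := exists_perm_opposite_pairs h3
    (h.sum_smul_add_smul (β i + β j) (-(α i + α j)))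
    (h.sum_smul_add_smul_cube _ _) hij hik hjk
    (by simp only [Pi.add_apply, Pi.smul_apply, smul_eq_mul]; ring)
  have hσ := h.comp_perm σ
  refine hσ.eq_zero_of_pairwise_eq h2 h3 ?_ ?_ ?_
  · simp only [Pi.add_apply, Pi.smul_apply, Function.comp_apply, smul_eq_mul]
    linear_combination 2 * hconst (σ 0) - 2 * hconst (σ 1)
  · refine mul_left_cancel₀ (hσ.pair_left 2 3 (by decide)) ?_
    simp only [Pi.add_apply, Pi.smul_apply, Function.comp_apply, smul_eq_mul] at h23 ⊢
    linear_combination 2 * (α (σ 0) + α (σ 1)) * (hconst (σ 2) - hconst (σ 3)) +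
      (b * (α (σ 2) - α (σ 3)) + 2 * c * (β (σ 2) - β (σ 3))) * h23
  · refine mul_left_cancel₀ (hσ.pair_left 4 5 (by decide)) ?_
    simp only [Pi.add_apply, Pi.smul_apply, Function.comp_apply, smul_eq_mul] at h45 ⊢
    linear_combination 2 * (α (σ 0) + α (σ 1)) * (hconst (σ 4) - hconst (σ 5)) +
      (b * (α (σ 4) - α (σ 5)) + 2 * c * (β (σ 4) - β (σ 5))) * h45

theorem eq_zero_of_quadratic_const (h2 : (2 : K) ≠ 0) (h3 : (3 : K) ≠ 0) {a b c n : K}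
    (hconst : ∀ i, a * α i ^ 2 + b * (α i * β i) + c * β i ^ 2 = n) : a = 0 ∧ b = 0 ∧ c = 0 := by
  have hpair {i j : Fin 6} (hij : i ≠ j) := h.add_mul_eq_of_quadratic_const h2 h3 hconst hij
  have hvanish {p q : K} (hpq : ∀ i j : Fin 6, i ≠ j → p * (α i + α j) + q * (β i + β j) = 0) :
      p = 0 ∧ q = 0 := by
    refine h.eq_zero_of_add_eq_zero h3 (show (0 : Fin 6) ≠ 1 by decide)
      (show (0 : Fin 6) ≠ 2 by decide) (by decide) ?_ ?_ <;>
    simp only [Pi.add_apply, Pi.smul_apply, smul_eq_mul]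
    · linear_combination hpq 0 1 (by decide)
    · linear_combination hpq 0 2 (by decide)
  obtain ⟨ha, hb⟩ := hvanish fun i j hij => (hpair hij).1
  obtain ⟨-, hc⟩ := hvanish fun i j hij => (hpair hij).2
  exact ⟨(mul_eq_zero.1 ha).resolve_left h2, hb, (mul_eq_zero.1 hc).resolve_left h2⟩

theorem segrePlane_injective (h2 : (2 : K) ≠ 0) (h3 : (3 : K) ≠ 0) :
    Function.Injective (segrePlane α β) := by
  refine (injective_iff_map_eq_zero _).2 fun c hc => ?_
  have h6 : (6 : K) ≠ 0 := by
    convert mul_ne_zero h2 h3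
    norm_num
  obtain ⟨hc0, hc1, hc2⟩ := h.eq_zero_of_quadratic_const h2 h3 (a := 6 * c 0) (b := 6 * c 1)
    (c := 6 * c 2) (n := c 0 * α ⬝ᵥ α + c 1 * α ⬝ᵥ β + c 2 * β ⬝ᵥ β) fun i => by
      have hi := congrFun hc i
      simp only [segrePlane_apply, segreProd, Pi.add_apply, Pi.smul_apply, smul_eq_mul,
        Pi.zero_apply] at hi
      linear_combination hi
  ext i
  fin_cases i
  · exact (mul_eq_zero.1 hc0).resolve_left h6
  · exact (mul_eq_zero.1 hc1).resolve_left h6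
  · exact (mul_eq_zero.1 hc2).resolve_left h6

theorem linearIndependent_one (h2 : (2 : K) ≠ 0) (h3 : (3 : K) ≠ 0) :
    LinearIndependent K ![1, α, β] := by
  refine LinearIndependent.finCons h.linearIndependent fun hmem => ?_
  rw [Matrix.range_cons_cons_empty, Submodule.mem_span_pair] at hmem
  obtain ⟨p, q, hpq⟩ := hmem
  have hsum := h.sum_smul_add_smul p q
  simp only [hpq, Pi.one_apply, Finset.sum_const, Finset.card_univ, Fintype.card_fin,
    nsmul_eq_mul, mul_one] at hsum
  refine mul_ne_zero h2 h3 (Eq.trans ?_ hsum)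
  norm_num

theorem mem_range_segrePlane_iff (h2 : (2 : K) ≠ 0) (h3 : (3 : K) ≠ 0) {v : Fin 6 → K} :
    v ∈ LinearMap.range (segrePlane α β) ↔ ∑ i, v i = 0 ∧ α ⬝ᵥ v = 0 ∧ β ⬝ᵥ v = 0 := by
  have hker {v : Fin 6 → K} : v ∈ LinearMap.ker (Matrix.of ![1, α, β]).mulVecLin ↔
      ∑ i, v i = 0 ∧ α ⬝ᵥ v = 0 ∧ β ⬝ᵥ v = 0 := by
    simp [LinearMap.mem_ker, funext_iff, Fin.forall_fin_succ, one_dotProduct]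
  rw [← hker]
  suffices heq : LinearMap.range (segrePlane α β) =
      LinearMap.ker (Matrix.of ![1, α, β]).mulVecLin by rw [heq]
  refine Submodule.eq_of_le_of_finrank_eq ?_ ?_
  · rintro _ ⟨c, rfl⟩
    have h30 := h.cube_left
    have h21 := h.sq_left
    have h12 := h.sq_right
    have h03 := h.cube_right
    simp only [Fin.sum_univ_six] at h30 h21 h12 h03
    refine hker.2 ⟨?_, ?_, ?_⟩
    · simp only [segrePlane_apply, Pi.add_apply, Pi.smul_apply, Finset.sum_add_distrib,
        ← Finset.smul_sum, sum_segreProd, smul_zero, add_zero]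
    · rw [dotProduct_segrePlane h.sum_left, Fin.sum_univ_six]
      linear_combination 6 * (c 0 * h30 + c 1 * h21 + c 2 * h12)
    · rw [dotProduct_segrePlane h.sum_right, Fin.sum_univ_six]
      linear_combination 6 * (c 0 * h21 + c 1 * h12 + c 2 * h03)
  · have hrank := LinearMap.finrank_range_add_finrank_ker (Matrix.of ![1, α, β]).mulVecLin
    rw [← Matrix.rank, LinearIndependent.rank_matrix (M := Matrix.of ![1, α, β])
      (h.linearIndependent_one h2 h3)] at hrank
    rw [LinearMap.finrank_range_of_inj (h.segrePlane_injective h2 h3)]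
    simp only [Module.finrank_fintype_fun_eq_card, Fintype.card_fin] at hrank ⊢
    omega

theorem polar₄_conic_eq_zero (z : Fin 6 → K) (hz : z ∈ LinearMap.range (segrePlane α β))
    (h2 : (2 : K) ≠ 0) (h3 : (3 : K) ≠ 0) (t : K) :
    polar₄ (segrePlane α β ![1, 2 * t, t ^ 2]) (segrePlane α β ![1, 2 * t, t ^ 2])
      (segrePlane α β ![1, 2 * t, t ^ 2]) z = 0 := by
  obtain ⟨hsum, hα, hβ⟩ := (h.mem_range_segrePlane_iff h2 h3).1 hz
  obtain ⟨e, he, -⟩ := exists_polar₄_segreProd_eq (h.sum_smul_add_smul 1 t)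
    (h.sum_smul_add_smul_cube 1 t)
  have hz := he z hsum
  rw [segreProd_smul_add_smul_self, add_dotProduct, smul_dotProduct, smul_dotProduct, hα, hβ] at hz
  simpa using hz

/-- The first polars of the quartic vanish on the conic of the squares, which determines the quartic
form on the plane up to a constant. -/
theorem polar₄_segrePlane [Infinite K] (h2 : (2 : K) ≠ 0) (h3 : (3 : K) ≠ 0)
    (a b c d : Fin 3 → K) :
    8 * polar₄ (segrePlane α β a) (segrePlane α β b) (segrePlane α β c) (segrePlane α β d) =
      polar₄ (segreProd α α) (segreProd α α) (segreProd β β) (segreProd β β) *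
        (discPairing a b * discPairing c d + discPairing a c * discPairing b d +
          discPairing a d * discPairing b c) := by
  have htable (e : Fin 3 → K) := polar₄_cube_coeff h2 h3
    (u := segreProd α α) (v := segreProd α β) (w := segreProd β β) (z := segrePlane α β e)
    fun t => by
      have ht := h.polar₄_conic_eq_zero (segrePlane α β e) ⟨e, rfl⟩ h2 h3 t
      simpa only [segrePlane_apply, Matrix.cons_val, one_smul] using ht
  obtain ⟨uuuu, uuuv, uuuw, -, uuww, uvww, uwww⟩ := htable ![1, 0, 0]
  obtain ⟨-, uuvv, uvvv, vvvv, -, vvww, vwww⟩ := htable ![0, 1, 0]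
  obtain ⟨-, uuvw, -, vvvw, -, -, wwww⟩ := htable ![0, 0, 1]
  clear htable
  simp only [segrePlane_apply, Matrix.cons_val, one_smul, zero_smul, add_zero, zero_add] at *
  generalize segreProd α α = u, segreProd α β = v, segreProd β β = w at *
  simp only [polar₄_add₁, polar₄_add₂, polar₄_add₃, polar₄_add₄, polar₄_smul₁, polar₄_smul₂,
    polar₄_smul₃, polar₄_smul₄, polar₄_swap₁₂ v u, polar₄_swap₁₂ w u, polar₄_swap₁₂ w v,
    polar₄_swap₂₃ _ v u, polar₄_swap₂₃ _ w u, polar₄_swap₂₃ _ w v, polar₄_swap₃₄ _ _ v u,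
    polar₄_swap₃₄ _ _ w u, polar₄_swap₃₄ _ _ w v] at *
  have h4 : (4 : K) ≠ 0 := by
    rw [show (4 : K) = 2 * 2 by norm_num]
    exact mul_ne_zero h2 h2
  simp only [uuvv, uuvw, uvww, mul_zero, add_zero, zero_add, mul_eq_zero, h2, h4, false_or]
    at uuuw uvvv vvvw
  rw [eq_neg_of_add_eq_zero_left uuww]
  simp only [uuuu, uuuv, uuuw, uuvv, uuvw, uvvv, uvww, uwww, vvvw, vvww, vwww, wwww, discPairing,
    mul_zero, add_zero, zero_add]
  linear_combination 4 * a 1 * b 1 * c 1 * d 1 * vvvv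

theorem exists_eq_smul_add_smul (h2 : (2 : K) ≠ 0) (h3 : (3 : K) ≠ 0) {l : Fin 6 → K}
    (hl : ∑ i, l i = 0) (hperp : ∀ v ∈ LinearMap.range (segrePlane α β), l ⬝ᵥ v = 0) :
    ∃ p q : K, l = p • α + q • β := by
  have hspan : l ∈ Submodule.span K (Set.range ![1, α, β]) :=
    mem_span_range_of_forall_dotProduct fun v hv => hperp v <|
      (h.mem_range_segrePlane_iff h2 h3).2 ⟨(one_dotProduct v).symm.trans (hv 0), hv 1, hv 2⟩
  obtain ⟨c, rfl⟩ := Submodule.mem_span_range_iff_exists_fun K |>.1 hspan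
  simp only [Fin.sum_univ_three, Matrix.cons_val, Pi.add_apply, Pi.smul_apply, Pi.one_apply,
    smul_eq_mul, mul_one, Finset.sum_add_distrib, ← Finset.mul_sum, h.sum_left, h.sum_right,
    mul_zero, add_zero, Finset.sum_const, Finset.card_univ, Fintype.card_fin] at hl ⊢
  have hc : 2 * 3 * c 0 = 0 := by
    linear_combination hl
  simp only [mul_eq_zero, h2, h3, false_or] at hc
  exact ⟨c 1, c 2, by rw [hc, zero_smul, zero_add]⟩

theorem exists_triple_ne [Infinite K] : ∃ t : K, t ≠ 0 ∧ ∀ i j k, i ≠ j → i ≠ k → j ≠ k →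
    (segreProd α α + t • segreProd α β) i + (segreProd α α + t • segreProd α β) j +
      (segreProd α α + t • segreProd α β) k ≠ 0 := by
  classical
  obtain ⟨t, ht⟩ := Infinite.exists_notMem_finset <| insert (0 : K) <|
    Finset.univ.image fun i : Fin 6 × Fin 6 × Fin 6 =>
      -(segreProd α α i.1 + segreProd α α i.2.1 + segreProd α α i.2.2) /
        (segreProd α β i.1 + segreProd α β i.2.1 + segreProd α β i.2.2)
  simp only [Finset.mem_insert, Finset.mem_image, Finset.mem_univ, true_and, Prod.exists,
    not_or, not_exists] at ht
  refine ⟨t, ht.1, fun i j k hij hik hjk hzero => ht.2 i j k ?_⟩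
  simp only [Pi.add_apply, Pi.smul_apply, smul_eq_mul] at hzero
  have hne : segreProd α β i + segreProd α β j + segreProd α β k ≠ 0 := fun h0 =>
    h.triple_left i j k hij hik hjk (by linear_combination hzero - t * h0)
  rw [div_eq_iff hne]
  linear_combination -hzero

/-- Otherwise the plane lies on the quartic and contains a point outside the ten hyperplanes, which
is a multiple of the square of its polarity and hence on the conic of squares. -/
theorem polar₄_ne_zero [Infinite K] (h2 : (2 : K) ≠ 0) (h3 : (3 : K) ≠ 0) :
    polar₄ (segreProd α α) (segreProd α α) (segreProd β β) (segreProd β β) ≠ 0 := by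
  intro h0
  have hvanish (a b c d : Fin 3 → K) : polar₄ (segrePlane α β a) (segrePlane α β b)
      (segrePlane α β c) (segrePlane α β d) = 0 := by
    have h8 : 2 * 2 * 2 * polar₄ (segrePlane α β a) (segrePlane α β b) (segrePlane α β c)
        (segrePlane α β d) = 0 := by
      linear_combination h.polar₄_segrePlane h2 h3 a b c d + h0 *
        (discPairing a b * discPairing c d + discPairing a c * discPairing b d +
          discPairing a d * discPairing b c)
    simpa only [mul_eq_zero, h2, false_or] using h8
  obtain ⟨t, ht, htriple⟩ := h.exists_triple_ne
  have hz : segreProd α α + t • segreProd α β = segrePlane α β ![1, t, 0] := by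
    simp [segrePlane_apply]
  rw [hz] at htriple
  have hgen : IsGeneralPoint (segrePlane α β ![1, t, 0]) :=
    ⟨((h.mem_range_segrePlane_iff h2 h3).1 ⟨_, rfl⟩).1, hvanish _ _ _ _, htriple⟩
  obtain ⟨p, q, hpq⟩ := h.exists_eq_smul_add_smul h2 h3 (sum_gauss hgen.sum_eq) <| by
    rintro _ ⟨c, rfl⟩
    rw [gauss_dotProduct _ ((h.mem_range_segrePlane_iff h2 h3).1 ⟨_, rfl⟩).1, hvanish]
  obtain ⟨D, hD, hsq⟩ := hgen.exists_segreProd_gauss_eq h2 h3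
  rw [hpq, segreProd_smul_add_smul_self, ← map_smul] at hsq
  have hcoord := h.segrePlane_injective h2 h3 hsq
  have hq : q = 0 := by simpa using congrFun hcoord 2
  exact mul_ne_zero hD ht (by simpa [hq] using (congrFun hcoord 1).symm)

theorem exists_perm_segreProd_eq (h2 : (2 : K) ≠ 0) (h3 : (3 : K) ≠ 0) {p q : K}
    (hpq : ¬(p = 0 ∧ q = 0)) {i j : Fin 6} (hij : i ≠ j)
    (hγ : (p • α + q • β) i + (p • α + q • β) j = 0) : ∃ (σ : Equiv.Perm (Fin 6)) (a b c : K),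
      segreProd (p • α + q • β) (p • α + q • β) ∘ σ = ![a, a, b, b, c, c] ∧ a + b + c = 0 ∧
      a ≠ b ∧ b ≠ c ∧ c ≠ a := by
  obtain ⟨k, hik, hjk⟩ := exists_ne_and_ne i j
  obtain ⟨σ, rfl, rfl, -, h23, h45⟩ := exists_perm_opposite_pairs h3 (h.sum_smul_add_smul p q)
    (h.sum_smul_add_smul_cube p q) hij hik hjk hγ
  refine ⟨σ, ?_⟩
  rw [← segreProd_comp_perm]
  exact exists_segreProd_eq_pairs h2 h3 hγ h23 h45 fun i j k hij hik hjk h₁ h₂ =>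
    hpq ((h.comp_perm σ).eq_zero_of_add_eq_zero h3 hij hik hjk h₁ h₂)

theorem exists_eq_smul_segreProd (h2 : (2 : K) ≠ 0) (h3 : (3 : K) ≠ 0) {p q : K}
    (hpq : ¬(p = 0 ∧ q = 0)) {i j : Fin 6} (hij : i ≠ j)
    (hγ : (p • α + q • β) i + (p • α + q • β) j = 0) {f : Fin 6 → K} (hf : ∑ i, f i = 0)
    (hpair : ∀ i j, i ≠ j → f i + f j ≠ 0)
    (hfγ : f ⬝ᵥ segreProd (p • α + q • β) (p • α + q • β) = 0) {v : Fin 6 → K}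
    (hv : ∑ i, v i = 0) (hfv : f ⬝ᵥ v = 0) (hker : ∀ w, ∑ i, w i = 0 → f ⬝ᵥ w = 0 →
      polar₄ (segreProd (p • α + q • β) (p • α + q • β))
        (segreProd (p • α + q • β) (p • α + q • β)) v w = 0) :
    ∃ r : K, v = r • segreProd (p • α + q • β) (p • α + q • β) := by
  obtain ⟨σ, a, b, c, hP, habc, hab, hbc, hca⟩ := h.exists_perm_segreProd_eq h2 h3 hpq hij hγ
  generalize segreProd (p • α + q • β) (p • α + q • β) = P at *
  obtain ⟨r, hr⟩ := exists_eq_smul_of_polar₄_pairs_eq_zero h2 h3 habc hab hbc hca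
    (f := f ∘ σ) (v := v ∘ σ) ((Equiv.sum_comp σ f).trans hf)
    (hpair _ _ (σ.injective.ne (by decide))) (by rw [← hP, comp_equiv_dotProduct_comp_equiv, hfγ])
    ((Equiv.sum_comp σ v).trans hv) (by rw [comp_equiv_dotProduct_comp_equiv, hfv])
    fun w hw hfw => by
      have hw' := hker (w ∘ σ.symm) ((Equiv.sum_comp σ.symm w).trans hw) <| by
        rw [← comp_equiv_dotProduct_comp_equiv f _ σ, Function.comp_assoc, Equiv.symm_comp_self]
        exact hfw
      rwa [← polar₄_comp_perm _ _ _ _ σ, Function.comp_assoc, Equiv.symm_comp_self, hP] at hw'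
  refine ⟨r, funext fun i => ?_⟩
  rw [← hP] at hr
  simpa using congrFun hr (σ.symm i)

theorem segreProd_oppositePoint_ne_smul_left (h2 : (2 : K) ≠ 0) (h3 : (3 : K) ≠ 0) (j : Fin 5)
    (r : K) : segreProd (oppositePoint α β j) (oppositePoint α β j) ≠ r • segreProd α α := by
  intro heq
  rw [oppositePoint, segreProd_smul_add_smul_self, ← segrePlane_single_zero, ← map_smul] at heq
  have hcoord := congrFun (h.segrePlane_injective h2 h3 heq) 2
  simp only [Matrix.cons_val, Pi.smul_apply, smul_eq_mul, mul_zero, neg_sq, pow_eq_zero_iff,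
    Ne, OfNat.ofNat_ne_zero, not_false_eq_true] at hcoord
  exact h.pair_left 0 j.succ (Fin.succ_ne_zero j).symm hcoord

theorem segreProd_oppositePoint_ne_smul_right (h2 : (2 : K) ≠ 0) (h3 : (3 : K) ≠ 0) (j : Fin 5)
    (r : K) : segreProd (oppositePoint α β j) (oppositePoint α β j) ≠ r • segreProd β β := by
  intro heq
  rw [oppositePoint, segreProd_smul_add_smul_self, ← segrePlane_single_two, ← map_smul] at heq
  have hcoord := congrFun (h.segrePlane_injective h2 h3 heq) 0
  simp only [Matrix.cons_val, Pi.smul_apply, smul_eq_mul, mul_zero, neg_sq, pow_eq_zero_iff,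
    Ne, OfNat.ofNat_ne_zero, not_false_eq_true] at hcoord
  exact h.pair_right 0 j.succ (Fin.succ_ne_zero j).symm hcoord

theorem segreProd_oppositePoint_ne_smul (h2 : (2 : K) ≠ 0) (h3 : (3 : K) ≠ 0) {i j : Fin 5}
    (hij : i ≠ j) (r : K) : segreProd (oppositePoint α β i) (oppositePoint α β i) ≠
      r • segreProd (oppositePoint α β j) (oppositePoint α β j) := by
  intro heq
  have hadd := oppositePoint_add α β i
  have hpair := h.pair_right 0 i.succ (Fin.succ_ne_zero i).symm
  have hpair' := h.pair_right 0 j.succ (Fin.succ_ne_zero j).symm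
  refine hpair (h.eq_zero_of_add_eq_zero h3 (j := i.succ) (k := j.succ)
    (Fin.succ_ne_zero i).symm (Fin.succ_ne_zero j).symm
    ((Fin.succ_injective 5).ne hij) hadd ?_).1
  rw [oppositePoint, oppositePoint, segreProd_smul_add_smul_self, segreProd_smul_add_smul_self,
    ← map_smul] at heq
  have hcoord := h.segrePlane_injective h2 h3 heq
  have h0 := congrFun hcoord 0
  have h1 := congrFun hcoord 1
  simp only [Matrix.cons_val, Pi.smul_apply, smul_eq_mul] at h0 h1
  simp only [Pi.add_apply, Pi.smul_apply, smul_eq_mul]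
  refine (mul_eq_zero.1 (show 2 * (β 0 + β i.succ) * (β 0 + β j.succ) * _ = 0 from ?_)).resolve_left
    (mul_ne_zero (mul_ne_zero h2 hpair) hpair')
  linear_combination (2 * (α 0 + α j.succ) * (β 0 + β j.succ)) * h0 + (β 0 + β j.succ) ^ 2 * h1

theorem two_mul_polarConic_segrePlane [Infinite K] (h2 : (2 : K) ≠ 0) (h3 : (3 : K) ≠ 0)
    (c d : Fin 3 → K) :
    2 * polarConic (segreProd α α) (segreProd β β) (segrePlane α β c) (segrePlane α β d) =
      -(polar₄ (segreProd α α) (segreProd α α) (segreProd β β) (segreProd β β) ^ 2 *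
        discPairing c d) := by
  have h8 : (8 : K) ≠ 0 := by
    rw [show (8 : K) = 2 ^ 3 by norm_num]
    exact pow_ne_zero 3 h2
  have hleft (c : Fin 3 → K) : polar₄ (segreProd α α) (segreProd α α) (segreProd β β)
      (segrePlane α β c) = polar₄ (segreProd α α) (segreProd α α) (segreProd β β) (segreProd β β) *
        c 2 := mul_left_cancel₀ h8 (by
    have hc := h.polar₄_segrePlane h2 h3 ![1, 0, 0] ![1, 0, 0] ![0, 0, 1] c
    simp only [segrePlane_single_zero, segrePlane_single_two, discPairing, Matrix.cons_val] at hc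
    linear_combination hc)
  have hright (c : Fin 3 → K) : polar₄ (segreProd β β) (segreProd β β) (segreProd α α)
      (segrePlane α β c) = polar₄ (segreProd α α) (segreProd α α) (segreProd β β) (segreProd β β) *
        c 0 := mul_left_cancel₀ h8 (by
    have hc := h.polar₄_segrePlane h2 h3 ![0, 0, 1] ![0, 0, 1] ![1, 0, 0] c
    simp only [segrePlane_single_zero, segrePlane_single_two, discPairing, Matrix.cons_val] at hc
    linear_combination hc)
  have hmixed := h.polar₄_segrePlane h2 h3 ![1, 0, 0] ![0, 0, 1] c d
  refine mul_left_cancel₀ h2 ?_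
  simp only [polarConic, hleft, hright]
  simp only [segrePlane_single_zero, segrePlane_single_two, discPairing, Matrix.cons_val]
    at hmixed ⊢
  linear_combination
    polar₄ (segreProd α α) (segreProd α α) (segreProd β β) (segreProd β β) * hmixed

end IsSegreLine

/-- Two distinct general points of the quartic with `P(x, y) = P(y, x) = 0`. -/
structure IsPolarPair (x y : Fin 6 → K) : Prop where
  left : IsGeneralPoint x
  right : IsGeneralPoint y
  polar_left : polar₄ x x x y = 0
  polar_right : polar₄ y y y x = 0
  ne_smul : ∀ c : K, y ≠ c • x

/-- `p` is a node of the section of the quartic by the tangent space at `x`. -/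
structure IsSectionNode (x p : Fin 6 → K) : Prop where
  sum_eq : ∑ i, p i = 0
  polar_eq : polar₄ x x x p = 0
  singular : ∀ v, ∑ i, v i = 0 → polar₄ p p p v = 0
  nondegenerate : ∀ v, ∑ i, v i = 0 → polar₄ x x x v = 0 →
    (∀ w, ∑ i, w i = 0 → polar₄ x x x w = 0 → polar₄ p p v w = 0) → ∃ r : K, v = r • p

/-- `p` is on the conic `polarConic x y` and a node of the sections of the quartic by the tangent
spaces at `x` and `y`. -/
structure IsCommonNode (x y p : Fin 6 → K) : Prop where
  left : IsSectionNode x p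
  right : IsSectionNode y p
  polarConic_eq : polarConic x y p p = 0

namespace IsPolarPair

variable {x y : Fin 6 → K} (h : IsPolarPair x y)
include h

theorem linearIndependent_gauss (h2 : (2 : K) ≠ 0) (h3 : (3 : K) ≠ 0) :
    LinearIndependent K ![gauss x, gauss y] := by
  obtain ⟨D, -, hx⟩ := h.left.exists_segreProd_gauss_eq h2 h3
  obtain ⟨D', hD', hy⟩ := h.right.exists_segreProd_gauss_eq h2 h3
  refine (LinearIndependent.pair_iff' (h.left.gauss_ne_zero h2 h3)).2 fun c hc => ?_
  refine h.ne_smul (D'⁻¹ * (c ^ 2 * D)) ?_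
  have hsq : segreProd (gauss y) (gauss y) = c ^ 2 • segreProd (gauss x) (gauss x) := by
    ext i
    simp only [← hc, segreProd, dotProduct_smul, smul_dotProduct, Pi.smul_apply, smul_eq_mul]
    ring
  rw [hx, hy] at hsq
  rw [mul_smul, mul_smul, ← hsq, inv_smul_smul₀ hD']

theorem isSegreLine_gauss (h2 : (2 : K) ≠ 0) (h3 : (3 : K) ≠ 0) :
    IsSegreLine (gauss x) (gauss y) where
  sum_left := sum_gauss h.left.sum_eq
  sum_right := sum_gauss h.right.sum_eq
  cube_left := h.left.sum_gauss_cube h2 h3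
  sq_left := h.left.sum_gauss_sq_mul_eq_zero h2 h3 (sum_gauss h.right.sum_eq) (by
    rw [dotProduct_comm, gauss_dotProduct y h.left.sum_eq, h.polar_right])
  sq_right := by
    simpa only [mul_comm] using
      h.right.sum_gauss_sq_mul_eq_zero h2 h3 (sum_gauss h.left.sum_eq) (by
        rw [dotProduct_comm, gauss_dotProduct x h.right.sum_eq, h.polar_left])
  cube_right := h.right.sum_gauss_cube h2 h3
  linearIndependent := h.linearIndependent_gauss h2 h3
  pair_left := h.left.gauss_add_gauss_ne_zero h2 h3
  pair_right := h.right.gauss_add_gauss_ne_zero h2 h3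
  triple_left i j k hij hik hjk := by
    obtain ⟨D, hD, hx⟩ := h.left.exists_segreProd_gauss_eq h2 h3
    rw [hx, Pi.smul_apply, Pi.smul_apply, Pi.smul_apply, ← smul_add, ← smul_add]
    exact smul_ne_zero hD (h.left.triple_ne i j k hij hik hjk)

theorem mem_range_segrePlane_iff (h2 : (2 : K) ≠ 0) (h3 : (3 : K) ≠ 0) (z : Fin 6 → K) :
    z ∈ LinearMap.range (segrePlane (gauss x) (gauss y)) ↔
      ∑ i, z i = 0 ∧ polar₄ x x x z = 0 ∧ polar₄ y y y z = 0 := by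
  rw [(h.isSegreLine_gauss h2 h3).mem_range_segrePlane_iff h2 h3]
  refine and_congr_right fun hz => ?_
  rw [gauss_dotProduct x hz, gauss_dotProduct y hz]

theorem exists_smul_eq (h2 : (2 : K) ≠ 0) (h3 : (3 : K) ≠ 0) : ∃ D D' : K, D ≠ 0 ∧ D' ≠ 0 ∧
    segreProd (gauss x) (gauss x) = D • x ∧ segreProd (gauss y) (gauss y) = D' • y := by
  obtain ⟨D, hD, hx⟩ := h.left.exists_segreProd_gauss_eq h2 h3
  obtain ⟨D', hD', hy⟩ := h.right.exists_segreProd_gauss_eq h2 h3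
  exact ⟨D, D', hD, hD', hx, hy⟩

variable [Infinite K] (h2 : (2 : K) ≠ 0) (h3 : (3 : K) ≠ 0)
include h2 h3

theorem polar₄_ne_zero : polar₄ x x y y ≠ 0 := fun h0 => by
  obtain ⟨D, D', -, -, hx, hy⟩ := h.exists_smul_eq h2 h3
  refine (h.isSegreLine_gauss h2 h3).polar₄_ne_zero h2 h3 ?_
  rw [hx, hy, polar₄_smul₁, polar₄_smul₂, polar₄_smul₃, polar₄_smul₄, h0]
  simp only [mul_zero]

theorem exists_two_mul_polarConic_segrePlane : ∃ r : K, r ≠ 0 ∧ ∀ c d : Fin 3 → K,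
    2 * polarConic x y (segrePlane (gauss x) (gauss y) c) (segrePlane (gauss x) (gauss y) d) =
      r * discPairing c d := by
  obtain ⟨D, D', hD, hD', hx, hy⟩ := h.exists_smul_eq h2 h3
  have hline := h.isSegreLine_gauss h2 h3
  have hρ := hline.polar₄_ne_zero h2 h3
  have hconic := hline.two_mul_polarConic_segrePlane h2 h3
  rw [hx, hy] at hρ hconic
  refine ⟨-(polar₄ (D • x) (D • x) (D' • y) (D' • y) ^ 2 / (D ^ 3 * D' ^ 3)), ?_, fun c d => ?_⟩
  · exact neg_ne_zero.2 (div_ne_zero (pow_ne_zero 2 hρ)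
      (mul_ne_zero (pow_ne_zero 3 hD) (pow_ne_zero 3 hD')))
  · have hcd := hconic c d
    rw [polarConic_smul_smul] at hcd
    field_simp
    linear_combination hcd

theorem two_mul_polar₄_eq (z : Fin 6 → K) (hsum : ∑ i, z i = 0) (hxz : polar₄ x x x z = 0)
    (hyz : polar₄ y y y z = 0) :
    2 * polar₄ x x y y ^ 3 * polar₄ z z z z = 3 * polarConic x y z z ^ 2 := by
  obtain ⟨D, D', hD, hD', hx, hy⟩ := h.exists_smul_eq h2 h3
  have hline := h.isSegreLine_gauss h2 h3
  obtain ⟨c, rfl⟩ := (h.mem_range_segrePlane_iff h2 h3 z).2 ⟨hsum, hxz, hyz⟩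
  have hconic := hline.two_mul_polarConic_segrePlane h2 h3 c c
  have hquartic := hline.polar₄_segrePlane h2 h3 c c c c
  generalize segrePlane (gauss x) (gauss y) c = z at *
  rw [hx, hy, polarConic_smul_smul] at hconic
  rw [hx, hy] at hquartic
  simp only [polar₄_smul₁, polar₄_smul₂, polar₄_smul₃, polar₄_smul₄] at hconic hquartic
  refine mul_left_cancel₀ (mul_ne_zero (pow_ne_zero 2 h2)
    (mul_ne_zero (pow_ne_zero 6 hD) (pow_ne_zero 6 hD'))) ?_
  linear_combination (D ^ 6 * D' ^ 6 * polar₄ x x y y ^ 3) * hquartic - 3 *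
    (2 * D ^ 3 * D' ^ 3 * polarConic x y z z - (D ^ 2 * D' ^ 2 * polar₄ x x y y) ^ 2 *
      discPairing c c) * hconic

theorem eq_zero_of_polarConic_eq_zero (z : Fin 6 → K) (hsum : ∑ i, z i = 0)
    (hxz : polar₄ x x x z = 0) (hyz : polar₄ y y y z = 0)
    (hz : ∀ w, ∑ i, w i = 0 → polar₄ x x x w = 0 → polar₄ y y y w = 0 → polarConic x y z w = 0) :
    z = 0 := by
  obtain ⟨r, hr, hconic⟩ := h.exists_two_mul_polarConic_segrePlane h2 h3
  obtain ⟨c, rfl⟩ := (h.mem_range_segrePlane_iff h2 h3 z).2 ⟨hsum, hxz, hyz⟩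
  have hdisc (d : Fin 3 → K) : discPairing c d = 0 := by
    obtain ⟨h0, hl, hr'⟩ := (h.mem_range_segrePlane_iff h2 h3 _).1 ⟨d, rfl⟩
    have hcd := hconic c d
    rw [hz _ h0 hl hr', mul_zero] at hcd
    exact (mul_eq_zero.1 hcd.symm).resolve_left hr
  have hc0 := hdisc ![0, 0, 1]
  have hc1 := hdisc ![0, 1, 0]
  have hc2 := hdisc ![1, 0, 0]
  simp only [discPairing, Matrix.cons_val, mul_one, mul_zero, add_zero, zero_add, sub_zero,
    zero_sub, neg_eq_zero, mul_eq_zero, h2, false_or] at hc0 hc1 hc2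
  rw [show c = 0 by ext i; fin_cases i <;> assumption, map_zero]

theorem isCommonNode (j : Fin 5) : IsCommonNode x y
    (segreProd (oppositePoint (gauss x) (gauss y) j) (oppositePoint (gauss x) (gauss y) j)) := by
  have hline := h.isSegreLine_gauss h2 h3
  have h0j : 0 ≠ j.succ := (Fin.succ_ne_zero j).symm
  have hadd := oppositePoint_add (gauss x) (gauss y) j
  have hpq : ¬(gauss y 0 + gauss y j.succ = 0 ∧ -(gauss x 0 + gauss x j.succ) = 0) := fun h0 =>
    hline.pair_right 0 j.succ h0j h0.1
  have hcoeff := segreProd_smul_add_smul_self (gauss x) (gauss y) (gauss y 0 + gauss y j.succ)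
    (-(gauss x 0 + gauss x j.succ))
  obtain ⟨hsum, hleft, hright⟩ := (h.mem_range_segrePlane_iff h2 h3 _).1 ⟨_, hcoeff.symm⟩
  have hsingular (v : Fin 6 → K) (hv : ∑ i, v i = 0) :
      polar₄ (segreProd (oppositePoint (gauss x) (gauss y) j) (oppositePoint (gauss x) (gauss y) j))
        (segreProd (oppositePoint (gauss x) (gauss y) j) (oppositePoint (gauss x) (gauss y) j))
        (segreProd (oppositePoint (gauss x) (gauss y) j) (oppositePoint (gauss x) (gauss y) j))
        v = 0 := by
    obtain ⟨e, he, hzero⟩ := exists_polar₄_segreProd_eq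
      (hline.sum_smul_add_smul (gauss y 0 + gauss y j.succ) (-(gauss x 0 + gauss x j.succ)))
      (hline.sum_smul_add_smul_cube _ _)
    exact (he v hv).trans (by rw [hzero 0 j.succ h0j hadd, zero_mul])
  refine ⟨⟨hsum, hleft, hsingular, fun v hv hxv hker => ?_⟩,
    ⟨hsum, hright, hsingular, fun v hv hyv hker => ?_⟩, ?_⟩
  · refine hline.exists_eq_smul_segreProd h2 h3 hpq h0j hadd hline.sum_left hline.pair_left
      ((gauss_dotProduct x hsum).trans hleft) hv ((gauss_dotProduct x hv).trans hxv)
      fun w hw hxw => hker w hw ((gauss_dotProduct x hw).symm.trans hxw)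
  · refine hline.exists_eq_smul_segreProd h2 h3 hpq h0j hadd hline.sum_right hline.pair_right
      ((gauss_dotProduct y hsum).trans hright) hv ((gauss_dotProduct y hv).trans hyv)
      fun w hw hyw => hker w hw ((gauss_dotProduct y hw).symm.trans hyw)
  · obtain ⟨r, -, hconic⟩ := h.exists_two_mul_polarConic_segrePlane h2 h3
    refine (mul_eq_zero.1 (show (2 : K) * _ = 0 from ?_)).resolve_left h2
    rw [oppositePoint, hcoeff, hconic]
    simp only [discPairing, Matrix.cons_val]
    ring

theorem exists_isCommonNode : ∃ p : Fin 5 → Fin 6 → K, (∀ j, IsCommonNode x y (p j)) ∧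
    (∀ j (r : K), p j ≠ r • x) ∧ (∀ j (r : K), p j ≠ r • y) ∧
      ∀ i j, i ≠ j → ∀ r : K, p i ≠ r • p j := by
  obtain ⟨D, D', hD, hD', hx, hy⟩ := h.exists_smul_eq h2 h3
  have hline := h.isSegreLine_gauss h2 h3
  refine ⟨_, h.isCommonNode h2 h3, fun j r heq => ?_, fun j r heq => ?_, fun i j hij r =>
    hline.segreProd_oppositePoint_ne_smul h2 h3 hij r⟩
  · refine hline.segreProd_oppositePoint_ne_smul_left h2 h3 j (r * D⁻¹) ?_
    rw [hx, mul_smul, inv_smul_smul₀ hD, heq]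
  · refine hline.segreProd_oppositePoint_ne_smul_right h2 h3 j (r * D'⁻¹) ?_
    rw [hy, mul_smul, inv_smul_smul₀ hD', heq]

end IsPolarPair

end SegreCubic

open MvPolynomial
open scoped Matrix

section Forms

variable {R : Type*} [CommRing R]

/-- The derivative in the direction `v`. -/
def dirDeriv (v : Fin 5 → R) :
    Derivation R (MvPolynomial (Fin 5) R) (MvPolynomial (Fin 5) R) :=
  ∑ i, v i • pderiv i

theorem dirDeriv_apply (v : Fin 5 → R) (P : MvPolynomial (Fin 5) R) :
    dirDeriv v P = ∑ i, v i • pderiv i P := by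
  rw [dirDeriv, ← Derivation.coeFnAddMonoidHom_apply, map_sum, Finset.sum_apply]
  rfl

theorem isHomogeneous_dirDeriv {P : MvPolynomial (Fin 5) R} {n : ℕ}
    (hP : P.IsHomogeneous (n + 1)) (v : Fin 5 → R) : (dirDeriv v P).IsHomogeneous n := by
  rw [dirDeriv_apply]
  refine IsHomogeneous.sum _ _ _ fun i _ => ?_
  rw [smul_eq_C_mul]
  exact hP.pderiv.C_mul _

theorem map_dirDeriv {S : Type*} [CommRing S] (f : R →+* S) (v : Fin 5 → R)
    (P : MvPolynomial (Fin 5) R) : map f (dirDeriv v P) = dirDeriv (f ∘ v) (map f P) := by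
  simp only [dirDeriv_apply, map_sum, smul_eq_C_mul, map_mul, map_C, pderiv_map,
    Function.comp_apply]

/-- The linear form with the given coefficients. -/
def linearForm (c : Fin 5 → R) : MvPolynomial (Fin 5) R := ∑ i, C (c i) * X i

theorem eval_linearForm (v c : Fin 5 → R) : eval v (linearForm c) = c ⬝ᵥ v := by
  simp [linearForm, dotProduct]

theorem dirDeriv_linearForm (v c : Fin 5 → R) : dirDeriv v (linearForm c) = C (c ⬝ᵥ v) := by
  simp [dirDeriv_apply, linearForm, dotProduct, pderiv_X, Pi.single_apply, smul_eq_C_mul, mul_comm]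

variable {K : Type*} [Field K]

theorem polar_apply (F : MvPolynomial (Fin 5) K) (a v : Fin 5 → K) :
    polar F a v = eval a (dirDeriv v F) := by
  simp [polar, dirDeriv_apply, mul_comm]

theorem hessian_eq (F : MvPolynomial (Fin 5) K) (p v w : Fin 5 → K) :
    hessian F p v w = eval p (dirDeriv v (dirDeriv w F)) := by
  simp only [hessian, dirDeriv_apply, map_sum, Derivation.map_smul, smul_eval, Finset.mul_sum]
  rw [Finset.sum_comm]
  exact Finset.sum_congr rfl fun i _ => Finset.sum_congr rfl fun j _ => by ring

end Forms

section Derivation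

variable {R S A : Type*} [CommRing R] [CommRing S] [CommRing A] [Algebra R A]

theorem map_polar₄ (f : R →+* S) (a b c d : Fin 6 → R) :
    f (polar₄ a b c d) = polar₄ (f ∘ a) (f ∘ b) (f ∘ c) (f ∘ d) := by
  simp only [polar₄, map_sub, map_add, map_mul, map_sum, map_ofNat, RingHom.map_dotProduct,
    Function.comp_apply]

theorem map_polarConic (f : R →+* S) (x y z w : Fin 6 → R) :
    f (polarConic x y z w) = polarConic (f ∘ x) (f ∘ y) (f ∘ z) (f ∘ w) := by
  simp only [polarConic, map_sub, map_mul, map_ofNat, map_polar₄]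

theorem polar₄_zero₄ (a b c : Fin 6 → R) : polar₄ a b c 0 = 0 := by
  simpa using polar₄_smul₄ a b c 0 0

theorem polar₄_zero₃ (a b d : Fin 6 → R) : polar₄ a b 0 d = 0 := by
  rw [polar₄_swap₃₄, polar₄_zero₄]

theorem polar₄_zero₂ (a c d : Fin 6 → R) : polar₄ a 0 c d = 0 := by
  rw [polar₄_swap₂₃, polar₄_zero₃]

theorem polar₄_zero₁ (b c d : Fin 6 → R) : polar₄ 0 b c d = 0 := by
  rw [polar₄_swap₁₂, polar₄_zero₂]

theorem derivation_dotProduct (D : Derivation R A A) (a b : Fin 6 → A) :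
    D (a ⬝ᵥ b) = (D ∘ a) ⬝ᵥ b + a ⬝ᵥ (D ∘ b) := by
  simp only [dotProduct, map_sum, Derivation.leibniz, smul_eq_mul, Finset.sum_add_distrib,
    Function.comp_apply, mul_comm (b _)]
  exact add_comm _ _

theorem derivation_polar₄ (D : Derivation R A A) (a b c d : Fin 6 → A) :
    D (polar₄ a b c d) = polar₄ (D ∘ a) b c d + polar₄ a (D ∘ b) c d + polar₄ a b (D ∘ c) d +
      polar₄ a b c (D ∘ d) := by
  have hsum : D (∑ i, a i * b i * c i * d i) = ∑ i, D (a i) * b i * c i * d i +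
      ∑ i, a i * D (b i) * c i * d i + ∑ i, a i * b i * D (c i) * d i +
      ∑ i, a i * b i * c i * D (d i) := by
    simp only [map_sum, Derivation.leibniz, smul_eq_mul, ← Finset.sum_add_distrib]
    exact Finset.sum_congr rfl fun i _ => by ring
  have h12 : D (12 : A) = 0 := by simpa using D.map_natCast 12
  simp only [polar₄, map_sub, map_add, Derivation.leibniz, smul_eq_mul, derivation_dotProduct,
    hsum, h12, Function.comp_apply]
  ring

end Derivation

section LinearForms

variable {R : Type*} [CommRing R]

/-- The coordinates of the linear map with matrix `M`, as linear forms. -/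
def coordForms (M : Matrix (Fin 6) (Fin 5) R) : Fin 6 → MvPolynomial (Fin 5) R :=
  fun j => linearForm (M j)

variable (M : Matrix (Fin 6) (Fin 5) R) (v : Fin 5 → R) (x y z : Fin 6 → R)

theorem eval_comp_coordForms : eval v ∘ coordForms M = M *ᵥ v :=
  funext fun _ => by rw [Function.comp_apply, coordForms, eval_linearForm, Matrix.mulVec]

theorem eval_comp_C : eval v ∘ C ∘ x = x :=
  funext fun _ => by rw [Function.comp_apply, Function.comp_apply, eval_C]

theorem dirDeriv_comp_coordForms : dirDeriv v ∘ coordForms M = C ∘ (M *ᵥ v) :=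
  funext fun _ => by
    rw [Function.comp_apply, coordForms, dirDeriv_linearForm, Function.comp_apply, Matrix.mulVec]

theorem dirDeriv_comp_C : dirDeriv v ∘ C ∘ x = 0 :=
  funext fun _ => by rw [Function.comp_apply, Function.comp_apply, derivation_C, Pi.zero_apply]

theorem dirDeriv_polar₄ :
    dirDeriv v (polar₄ (coordForms M) (coordForms M) (coordForms M) (coordForms M)) =
      4 * polar₄ (coordForms M) (coordForms M) (coordForms M) (C ∘ (M *ᵥ v)) := by
  rw [derivation_polar₄, dirDeriv_comp_coordForms, polar₄_swap₁₂ (C ∘ _),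
    polar₄_swap₂₃ _ (C ∘ _), polar₄_swap₃₄ _ _ (C ∘ _)]
  ring

theorem dirDeriv_polar₄_C :
    dirDeriv v (polar₄ (coordForms M) (coordForms M) (coordForms M) (C ∘ x)) =
      3 * polar₄ (coordForms M) (coordForms M) (C ∘ (M *ᵥ v)) (C ∘ x) := by
  rw [derivation_polar₄, dirDeriv_comp_coordForms, dirDeriv_comp_C, polar₄_zero₄,
    polar₄_swap₁₂ (C ∘ _), polar₄_swap₂₃ _ (C ∘ _)]
  ring

theorem dirDeriv_polar₄_C_C :
    dirDeriv v (polar₄ (coordForms M) (coordForms M) (C ∘ x) (C ∘ y)) =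
      2 * polar₄ (coordForms M) (C ∘ (M *ᵥ v)) (C ∘ x) (C ∘ y) := by
  rw [derivation_polar₄, dirDeriv_comp_coordForms, dirDeriv_comp_C, dirDeriv_comp_C, polar₄_zero₄,
    polar₄_zero₃, polar₄_swap₁₂ (C ∘ _)]
  ring

theorem dirDeriv_polarConic :
    dirDeriv v (polarConic (C ∘ x) (C ∘ y) (coordForms M) (coordForms M)) =
      2 * polarConic (C ∘ x) (C ∘ y) (coordForms M) (C ∘ (M *ᵥ v)) := by
  have hconst : dirDeriv v (2 : MvPolynomial (Fin 5) R) = 0 := by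
    simpa using (dirDeriv v).map_natCast 2
  simp only [polarConic, map_sub, Derivation.leibniz, smul_eq_mul, derivation_polar₄, hconst,
    dirDeriv_comp_C, dirDeriv_comp_coordForms, polar₄_zero₁, polar₄_zero₂, polar₄_zero₃,
    polar₄_zero₄, polar₄_swap₃₄ _ _ (C ∘ (M *ᵥ v))]
  ring

end LinearForms

section ConicForm

variable {K : Type*} [Field K]

/-- The quadratic form over the field of definition that cuts out the conic of contact of the
hypersurface `F = 0` and the plane `T_a ∩ T_b`; it is `polarConic` without a choice of coordinates
for the Igusa quartic. -/
def conicForm (F : MvPolynomial (Fin 5) K) (a b : Fin 5 → K) : MvPolynomial (Fin 5) K :=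
  C (4 * hessian F a b b) * dirDeriv a (dirDeriv b F) -
    dirDeriv a (dirDeriv a (dirDeriv b F)) * dirDeriv a (dirDeriv b (dirDeriv b F))

theorem isHomogeneous_conicForm {F : MvPolynomial (Fin 5) K} (hF : F.IsHomogeneous 4)
    (a b : Fin 5 → K) : (conicForm F a b).IsHomogeneous 2 := by
  have hderiv : (dirDeriv a (dirDeriv b F)).IsHomogeneous 2 :=
    isHomogeneous_dirDeriv (isHomogeneous_dirDeriv hF b) a
  have hleft := isHomogeneous_dirDeriv hderiv a
  have hright := isHomogeneous_dirDeriv (isHomogeneous_dirDeriv (isHomogeneous_dirDeriv hF b) b) a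
  exact (hderiv.C_mul _).sub (hleft.mul hright)

variable {L : Type*} [Field L]

theorem map_hessian (f : K →+* L) (F : MvPolynomial (Fin 5) K) (p v w : Fin 5 → K) :
    hessian (map f F) (f ∘ p) (f ∘ v) (f ∘ w) = f (hessian F p v w) := by
  rw [hessian_eq, hessian_eq, ← map_dirDeriv, ← map_dirDeriv, map_eval]

theorem map_polar (f : K →+* L) (F : MvPolynomial (Fin 5) K) (p v : Fin 5 → K) :
    polar (map f F) (f ∘ p) (f ∘ v) = f (polar F p v) := by
  rw [polar_apply, polar_apply, ← map_dirDeriv, map_eval]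

theorem map_conicForm (f : K →+* L) (F : MvPolynomial (Fin 5) K) (a b : Fin 5 → K) :
    map f (conicForm F a b) = conicForm (map f F) (f ∘ a) (f ∘ b) := by
  simp only [conicForm, map_sub, map_mul, map_C, map_dirDeriv, map_hessian, map_ofNat]

end ConicForm

theorem mem_sumZero {L : Type*} [Field L] {x : Fin 6 → L} : x ∈ sumZero L ↔ ∑ j, x j = 0 := by
  simp only [sumZero, LinearMap.mem_ker, LinearMap.sum_apply, LinearMap.proj_apply]

/-- The quartic form `G` is, up to the constant `c`, the quartic form of the symmetric form `polar₄`
composed with the linear isomorphism `M` from `L⁵` to the hyperplane `∑ xⱼ = 0` in `L⁶`. -/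
structure IsIgusaModel {L : Type*} [Field L] (G : MvPolynomial (Fin 5) L)
    (M : Matrix (Fin 6) (Fin 5) L) (c : L) : Prop where
  ne_zero : c ≠ 0
  eq : G = C c * polar₄ (coordForms M) (coordForms M) (coordForms M) (coordForms M)
  sum_mulVec : ∀ v, ∑ j, (M *ᵥ v) j = 0
  injective : Function.Injective M.mulVec

namespace IsIgusaModel

variable {L : Type*} [Field L] {G : MvPolynomial (Fin 5) L} {M : Matrix (Fin 6) (Fin 5) L} {c : L}
  (hG : IsIgusaModel G M c)
include hG

theorem exists_mulVec_eq {z : Fin 6 → L} (hz : ∑ j, z j = 0) : ∃ v, M *ᵥ v = z := by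
  have hle : LinearMap.range M.mulVecLin ≤ sumZero L := by
    rintro _ ⟨v, rfl⟩
    exact mem_sumZero.2 (hG.sum_mulVec v)
  have hsum : (∑ j, LinearMap.proj j : Module.Dual L (Fin 6 → L)) ≠ 0 := fun h0 => by
    simpa using LinearMap.congr_fun h0 (Pi.single 0 1)
  have hrank := Module.Dual.finrank_ker_add_one_of_ne_zero hsum
  have heq : LinearMap.range M.mulVecLin = sumZero L := by
    refine Submodule.eq_of_le_of_finrank_eq hle ?_
    rw [LinearMap.finrank_range_of_inj hG.injective, Module.finrank_fin_fun]
    rw [Module.finrank_fin_fun] at hrank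
    exact (Nat.succ_injective hrank).symm
  exact heq.ge (mem_sumZero.2 hz)

theorem dirDeriv_eq (v : Fin 5 → L) : dirDeriv v G =
    C (4 * c) * polar₄ (coordForms M) (coordForms M) (coordForms M) (C ∘ (M *ᵥ v)) := by
  rw [hG.eq, ← smul_eq_C_mul, Derivation.map_smul, smul_eq_C_mul, dirDeriv_polar₄, map_mul,
    map_ofNat]
  ring

theorem dirDeriv_dirDeriv_eq (v w : Fin 5 → L) : dirDeriv v (dirDeriv w G) =
    C (12 * c) * polar₄ (coordForms M) (coordForms M) (C ∘ (M *ᵥ v)) (C ∘ (M *ᵥ w)) := by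
  rw [hG.dirDeriv_eq, ← smul_eq_C_mul, Derivation.map_smul, smul_eq_C_mul, dirDeriv_polar₄_C]
  simp only [map_mul, map_ofNat]
  ring

theorem dirDeriv_dirDeriv_dirDeriv_eq (u v w : Fin 5 → L) :
    dirDeriv u (dirDeriv v (dirDeriv w G)) =
      C (24 * c) * polar₄ (coordForms M) (C ∘ (M *ᵥ u)) (C ∘ (M *ᵥ v)) (C ∘ (M *ᵥ w)) := by
  rw [hG.dirDeriv_dirDeriv_eq, ← smul_eq_C_mul, Derivation.map_smul, smul_eq_C_mul,
    dirDeriv_polar₄_C_C]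
  simp only [map_mul, map_ofNat]
  ring

theorem eval_eq (p : Fin 5 → L) :
    eval p G = c * polar₄ (M *ᵥ p) (M *ᵥ p) (M *ᵥ p) (M *ᵥ p) := by
  rw [hG.eq, map_mul, eval_C, map_polar₄, eval_comp_coordForms]

theorem polar_eq (p v : Fin 5 → L) :
    polar G p v = 4 * c * polar₄ (M *ᵥ p) (M *ᵥ p) (M *ᵥ p) (M *ᵥ v) := by
  rw [polar_apply, hG.dirDeriv_eq, map_mul, eval_C, map_polar₄, eval_comp_coordForms, eval_comp_C]

theorem hessian_eq (p v w : Fin 5 → L) :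
    hessian G p v w = 12 * c * polar₄ (M *ᵥ p) (M *ᵥ p) (M *ᵥ v) (M *ᵥ w) := by
  rw [IgusaQuartic.hessian_eq, hG.dirDeriv_dirDeriv_eq, map_mul, eval_C, map_polar₄,
    eval_comp_coordForms, eval_comp_C, eval_comp_C]

theorem conicForm_eq (u v : Fin 5 → L) : conicForm G u v =
    C (288 * c ^ 2) *
      polarConic (C ∘ (M *ᵥ u)) (C ∘ (M *ᵥ v)) (coordForms M) (coordForms M) := by
  have hmixed : polar₄ (coordForms M) (coordForms M) (C ∘ (M *ᵥ u)) (C ∘ (M *ᵥ v)) =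
      polar₄ (C ∘ (M *ᵥ u)) (C ∘ (M *ᵥ v)) (coordForms M) (coordForms M) := by
    rw [polar₄_swap₂₃, polar₄_swap₁₂, polar₄_swap₃₄, polar₄_swap₂₃]
  have hrotate (a b d : Fin 6 → MvPolynomial (Fin 5) L) :
      polar₄ (coordForms M) a b d = polar₄ a b d (coordForms M) := by
    rw [polar₄_swap₁₂, polar₄_swap₂₃, polar₄_swap₃₄]
  rw [conicForm, hG.dirDeriv_dirDeriv_dirDeriv_eq, hG.dirDeriv_dirDeriv_dirDeriv_eq,
    hG.dirDeriv_dirDeriv_eq, hG.hessian_eq, hmixed, hrotate, hrotate, polarConic,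
    polar₄_swap₂₃ (C ∘ (M *ᵥ v)), polar₄_swap₁₂ (C ∘ (M *ᵥ v)) (C ∘ (M *ᵥ u)) (C ∘ (M *ᵥ v))]
  simp only [map_mul, map_pow, map_ofNat, map_polar₄]
  ring

theorem eval_conicForm (u v p : Fin 5 → L) : eval p (conicForm G u v) =
    288 * c ^ 2 * polarConic (M *ᵥ u) (M *ᵥ v) (M *ᵥ p) (M *ᵥ p) := by
  rw [hG.conicForm_eq, map_mul, eval_C, map_polarConic, eval_comp_C, eval_comp_C,
    eval_comp_coordForms]

theorem polar_conicForm (u v p w : Fin 5 → L) : polar (conicForm G u v) p w =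
    576 * c ^ 2 * polarConic (M *ᵥ u) (M *ᵥ v) (M *ᵥ p) (M *ᵥ w) := by
  rw [polar_apply, hG.conicForm_eq, ← smul_eq_C_mul, Derivation.map_smul, smul_eq_C_mul,
    dirDeriv_polarConic, map_mul (eval p), map_mul (eval p), eval_C, map_ofNat, map_polarConic,
    eval_comp_C, eval_comp_C, eval_comp_C, eval_comp_coordForms]
  ring

end IsIgusaModel

section LinearIdeal

variable {K : Type*} [Field K] {W : Submodule K (Fin 5 → K)}

theorem linearForm_mem_linearIdeal {c : Fin 5 → K} (hc : ∀ w ∈ W, c ⬝ᵥ w = 0) :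
    linearForm c ∈ linearIdeal W :=
  Ideal.subset_span ⟨c, hc, rfl⟩

theorem linearForm_add (c d : Fin 5 → K) : linearForm (c + d) = linearForm c + linearForm d := by
  simp [linearForm, add_mul, Finset.sum_add_distrib]

theorem linearIdeal_anti {W' : Submodule K (Fin 5 → K)} (hW : W ≤ W') :
    linearIdeal W' ≤ linearIdeal W :=
  Ideal.span_mono fun _ ⟨c, hc, hl⟩ => ⟨c, fun w hw => hc w (hW hw), hl⟩

theorem linearIdeal_inf (W W' : Submodule K (Fin 5 → K)) :
    linearIdeal (W ⊓ W') = linearIdeal W ⊔ linearIdeal W' := by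
  refine le_antisymm (Ideal.span_le.2 ?_)
    (sup_le (linearIdeal_anti inf_le_left) (linearIdeal_anti inf_le_right))
  rintro _ ⟨c, hc, rfl⟩
  have hmem : dotProductEquiv K (Fin 5) c ∈ W.dualAnnihilator ⊔ W'.dualAnnihilator := by
    rw [← Subspace.dualAnnihilator_inf_eq, Submodule.mem_dualAnnihilator]
    exact hc
  obtain ⟨f, hf, g, hg, hfg⟩ := Submodule.mem_sup.1 hmem
  obtain ⟨d, rfl⟩ := (dotProductEquiv K (Fin 5)).surjective f
  obtain ⟨e, rfl⟩ := (dotProductEquiv K (Fin 5)).surjective g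
  obtain rfl : d + e = c := (dotProductEquiv K (Fin 5)).injective ((map_add _ d e).trans hfg)
  change linearForm (d + e) ∈ linearIdeal W ⊔ linearIdeal W'
  rw [linearForm_add]
  exact Submodule.add_mem_sup
    (linearForm_mem_linearIdeal ((Submodule.mem_dualAnnihilator _).1 hf))
    (linearForm_mem_linearIdeal ((Submodule.mem_dualAnnihilator _).1 hg))

theorem finrank_ker_inf_ker {f g : Module.Dual K (Fin 5 → K)}
    (hfg : LinearIndependent K ![f, g]) :
    Module.finrank K ↥(LinearMap.ker f ⊓ LinearMap.ker g) = 3 := by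
  have hker : (Submodule.span K (Set.range ![f, g])).dualCoannihilator =
      LinearMap.ker f ⊓ LinearMap.ker g := by
    refine SetLike.coe_injective ?_
    rw [Submodule.coe_dualCoannihilator_span]
    ext v
    simp [and_comm]
  have hrank := Subspace.finrank_add_finrank_dualCoannihilator_eq
    (Submodule.span K (Set.range ![f, g]))
  rw [finrank_span_eq_card hfg, hker, Module.finrank_fin_fun, Fintype.card_fin] at hrank
  exact Nat.add_left_cancel hrank

theorem sub_bind₁_mem_linearIdeal {m : Matrix (Fin 5) (Fin 5) K} (hm : ∀ w ∈ W, m *ᵥ w = w)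
    (P : MvPolynomial (Fin 5) K) : P - bind₁ (fun j => linearForm (m j)) P ∈ linearIdeal W := by
  have hX (j : Fin 5) : X j - linearForm (m j) ∈ linearIdeal W := by
    have hform : X j - linearForm (m j) = linearForm (Pi.single j 1 - m j) := by
      simp [linearForm, sub_mul, Finset.sum_sub_distrib, Pi.single_apply]
    rw [hform]
    refine linearForm_mem_linearIdeal fun w hw => ?_
    rw [sub_dotProduct, single_one_dotProduct, sub_eq_zero]
    exact (congrFun (hm w hw) j).symm
  have hcomp : Ideal.Quotient.mkₐ K (linearIdeal W) =
      (Ideal.Quotient.mkₐ K (linearIdeal W)).comp (bind₁ fun j => linearForm (m j)) := by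
    refine algHom_ext fun j => ?_
    rw [AlgHom.comp_apply, bind₁_X_right]
    exact Ideal.Quotient.eq.2 (hX j)
  exact Ideal.Quotient.eq.1 (DFunLike.congr_fun hcomp P)

theorem mem_linearIdeal_of_eval_eq_zero {L : Type*} [Field L] [Infinite L] [Algebra K L]
    {P : MvPolynomial (Fin 5) K}
    (hP : ∀ v ∈ Submodule.span L (coordMap L '' (W : Set (Fin 5 → K))),
      eval v (map (algebraMap K L) P) = 0) : P ∈ linearIdeal W := by
  obtain ⟨π, hπ⟩ := W.subtype.exists_leftInverse_of_injective W.ker_subtype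
  set m := LinearMap.toMatrix' (W.subtype ∘ₗ π)
  have hm (v : Fin 5 → K) : m *ᵥ v = π v := LinearMap.toMatrix'_mulVec _ v
  have hfix (w : Fin 5 → K) (hw : w ∈ W) : m *ᵥ w = w := by
    rw [hm]
    exact congrArg Subtype.val (LinearMap.congr_fun hπ ⟨w, hw⟩)
  suffices hzero : bind₁ (fun j => linearForm (m j)) P = 0 by
    simpa [hzero] using sub_bind₁_mem_linearIdeal hfix P
  refine map_injective _ (algebraMap K L).injective (MvPolynomial.funext fun v => ?_)
  have hmem : m.map (algebraMap K L) *ᵥ v ∈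
      Submodule.span L (coordMap L '' (W : Set (Fin 5 → K))) := by
    rw [Matrix.mulVec_eq_sum]
    refine Submodule.sum_mem _ fun i _ => ?_
    rw [op_smul_eq_smul]
    refine Submodule.smul_mem _ _ (Submodule.subset_span ?_)
    refine ⟨m *ᵥ Pi.single i 1, by rw [hm]; exact Submodule.coe_mem _, ?_⟩
    ext j
    simp [coordMap]
  rw [map_zero, map_zero, map_bind₁, ← hP _ hmem]
  refine (eval₂Hom_bind₁ (RingHom.id L) v _ _).trans ?_
  congr 2
  ext j
  simp [linearForm, Matrix.mulVec, dotProduct]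

theorem linearIdeal_sup_sectionIdeal {T : Submodule K (Fin 5 → K)} (hW : W ≤ T)
    (F : MvPolynomial (Fin 5) K) :
    linearIdeal W ⊔ sectionIdeal T F = sectionIdeal W F := by
  rw [sectionIdeal, sectionIdeal, ← sup_assoc, sup_eq_left.2 (linearIdeal_anti hW)]

theorem sectionIdeal_sup_sectionIdeal (T T' : Submodule K (Fin 5 → K))
    (F : MvPolynomial (Fin 5) K) :
    sectionIdeal T F ⊔ sectionIdeal T' F = sectionIdeal (T ⊓ T') F := by
  rw [sectionIdeal, sectionIdeal, sectionIdeal, sup_sup_sup_comm, sup_idem, linearIdeal_inf]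

theorem sup_span_singleton_eq_of_sub_mem {A : Type*} [CommRing A] {I : Ideal A} {r s : A}
    (h : r - s ∈ I) : I ⊔ Ideal.span {r} = I ⊔ Ideal.span {s} := by
  have hle {r s : A} (h : r - s ∈ I) : I ⊔ Ideal.span {r} ≤ I ⊔ Ideal.span {s} := by
    refine sup_le le_sup_left ((Ideal.span_singleton_le_iff_mem _).2 ?_)
    rw [← sub_add_cancel r s]
    exact Submodule.add_mem_sup h (Ideal.mem_span_singleton_self s)
  exact le_antisymm (hle h) (hle (by rw [← neg_sub]; exact I.neg_mem h))

theorem sectionIdeal_eq_of_sub_mem {F P : MvPolynomial (Fin 5) K} {s : K} (hs : s ≠ 0)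
    (h : C s * F - P ∈ linearIdeal W) : sectionIdeal W F = linearIdeal W ⊔ Ideal.span {P} := by
  rw [sectionIdeal, ← Ideal.span_singleton_mul_left_unit ((isUnit_iff_ne_zero.2 hs).map C) F,
    sup_span_singleton_eq_of_sub_mem h]

end LinearIdeal

section BaseChange

variable {K L : Type*} [Field K] [Field L] [Algebra K L]

theorem polar_map_coordMap (F : MvPolynomial (Fin 5) K) (a v : Fin 5 → K) :
    polar (map (algebraMap K L) F) (coordMap L a) (coordMap L v) = algebraMap K L (polar F a v) :=
  map_polar _ F a v

theorem eq_smul_add_smul_of_coordMap {f g l : Module.Dual K (Fin 5 → K)}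
    {f' g' l' : Module.Dual L (Fin 5 → L)} (hf : ∀ v, f' (coordMap L v) = algebraMap K L (f v))
    (hg : ∀ v, g' (coordMap L v) = algebraMap K L (g v))
    (hl : ∀ v, l' (coordMap L v) = algebraMap K L (l v)) {r s : K} (h : l = r • f + s • g) :
    l' = algebraMap K L r • f' + algebraMap K L s • g' := by
  refine (Pi.basisFun L (Fin 5)).ext fun i => ?_
  have hi : Pi.basisFun L (Fin 5) i = coordMap L (Pi.single i (1 : K)) := by
    ext j
    simp [coordMap, Pi.single_apply, apply_ite (algebraMap K L)]
  simp only [hi, LinearMap.add_apply, LinearMap.smul_apply, smul_eq_mul, hf, hg, hl, h, map_add,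
    map_mul]

theorem ker_inf_ker_le_ker_of_coordMap {f g l : Module.Dual K (Fin 5 → K)}
    {f' g' l' : Module.Dual L (Fin 5 → L)} (hf : ∀ v, f' (coordMap L v) = algebraMap K L (f v))
    (hg : ∀ v, g' (coordMap L v) = algebraMap K L (g v))
    (hl : ∀ v, l' (coordMap L v) = algebraMap K L (l v))
    (h : LinearMap.ker f ⊓ LinearMap.ker g ≤ LinearMap.ker l) :
    LinearMap.ker f' ⊓ LinearMap.ker g' ≤ LinearMap.ker l' := by
  have hspan : l ∈ Submodule.span K {f, g} := by
    rw [← Matrix.range_cons_cons_empty f g ![]]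
    refine mem_span_of_iInf_ker_le_ker fun v hv => h ?_
    rw [Submodule.mem_iInf] at hv
    exact ⟨hv 0, hv 1⟩
  obtain ⟨r, s, hrs⟩ := Submodule.mem_span_pair.1 hspan
  rintro v ⟨hfv, hgv⟩
  rw [LinearMap.mem_ker, eq_smul_add_smul_of_coordMap hf hg hl hrs.symm, LinearMap.add_apply,
    LinearMap.smul_apply, LinearMap.smul_apply, LinearMap.mem_ker.1 hfv, LinearMap.mem_ker.1 hgv,
    smul_zero, smul_zero, add_zero]

theorem linearIndependent_of_coordMap {f g : Module.Dual K (Fin 5 → K)}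
    {f' g' : Module.Dual L (Fin 5 → L)} (hf : ∀ v, f' (coordMap L v) = algebraMap K L (f v))
    (hg : ∀ v, g' (coordMap L v) = algebraMap K L (g v)) (h : LinearIndependent L ![f', g']) :
    LinearIndependent K ![f, g] := by
  refine LinearIndependent.pair_iff.2 fun r s hrs => ?_
  have hzero := eq_smul_add_smul_of_coordMap (l' := 0) hf hg (fun v => by simp) hrs.symm
  have := LinearIndependent.pair_iff.1 h _ _ hzero.symm
  simpa using this

end BaseChange

namespace IsIgusaModel

variable {L : Type*} [Field L] {G : MvPolynomial (Fin 5) L} {M : Matrix (Fin 6) (Fin 5) L} {c : L}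
  (hG : IsIgusaModel G M c) {u v : Fin 5 → L}
include hG

theorem polar_eq_zero_iff (h2 : (2 : L) ≠ 0) (u p : Fin 5 → L) :
    polar G u p = 0 ↔ polar₄ (M *ᵥ u) (M *ᵥ u) (M *ᵥ u) (M *ᵥ p) = 0 := by
  have h4 : (4 : L) ≠ 0 := by
    rw [show (4 : L) = 2 ^ 2 by norm_num]
    exact pow_ne_zero 2 h2
  rw [hG.polar_eq, mul_eq_zero, or_iff_right (mul_ne_zero h4 hG.ne_zero)]

variable (h : IsPolarPair (M *ᵥ u) (M *ᵥ v)) (h2 : (2 : L) ≠ 0) (h3 : (3 : L) ≠ 0)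
include h h2 h3

theorem linearIndependent_polar : LinearIndependent L ![polar G u, polar G v] := by
  refine LinearIndependent.pair_iff.2 fun r s hrs => ?_
  refine LinearIndependent.pair_iff.1 (h.linearIndependent_gauss h2 h3) r s ?_
  refine eq_zero_of_forall_dotProduct h2 h3 ?_ fun z hz => ?_
  · simp [Finset.sum_add_distrib, ← Finset.mul_sum, sum_gauss h.left.sum_eq,
      sum_gauss h.right.sum_eq]
  · obtain ⟨w, rfl⟩ := hG.exists_mulVec_eq hz
    have hw := LinearMap.congr_fun hrs w
    simp only [LinearMap.add_apply, LinearMap.smul_apply, hG.polar_eq, smul_eq_mul,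
      LinearMap.zero_apply] at hw
    have hfactor : 2 ^ 2 * c ≠ 0 := mul_ne_zero (pow_ne_zero 2 h2) hG.ne_zero
    refine mul_left_cancel₀ hfactor ?_
    rw [add_dotProduct, smul_dotProduct, smul_dotProduct, gauss_dotProduct _ hz,
      gauss_dotProduct _ hz, smul_eq_mul, smul_eq_mul]
    linear_combination hw

variable [Infinite L]

theorem hessian_ne_zero : hessian G u v v ≠ 0 := by
  have h12 : (12 : L) ≠ 0 := by
    rw [show (12 : L) = 2 ^ 2 * 3 by norm_num]
    exact mul_ne_zero (pow_ne_zero 2 h2) h3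
  rw [hG.hessian_eq]
  exact mul_ne_zero (mul_ne_zero h12 hG.ne_zero) (h.polar₄_ne_zero h2 h3)

theorem conicForm_sq_eq {p : Fin 5 → L} (hu : polar G u p = 0) (hv : polar G v p = 0) :
    eval p (conicForm G u v) ^ 2 = 32 * hessian G u v v ^ 3 * eval p G := by
  rw [hG.polar_eq_zero_iff h2] at hu hv
  rw [hG.eval_conicForm, hG.hessian_eq, hG.eval_eq]
  linear_combination -27648 * c ^ 4 * h.two_mul_polar₄_eq h2 h3 _ (hG.sum_mulVec p) hu hv

theorem eq_zero_of_polar_conicForm_eq_zero {p : Fin 5 → L} (hu : polar G u p = 0)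
    (hv : polar G v p = 0)
    (hp : ∀ w, polar G u w = 0 → polar G v w = 0 → polar (conicForm G u v) p w = 0) : p = 0 := by
  have h576 : (576 : L) ≠ 0 := by
    rw [show (576 : L) = 2 ^ 6 * 3 ^ 2 by norm_num]
    exact mul_ne_zero (pow_ne_zero 6 h2) (pow_ne_zero 2 h3)
  simp only [hG.polar_eq_zero_iff h2] at hu hv hp
  refine hG.injective (Eq.trans ?_ (Matrix.mulVec_zero M).symm)
  refine h.eq_zero_of_polarConic_eq_zero h2 h3 _ (hG.sum_mulVec p) hu hv fun z hz hxz hyz => ?_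
  obtain ⟨w, rfl⟩ := hG.exists_mulVec_eq hz
  have hw := hp w hxz hyz
  rw [hG.polar_conicForm] at hw
  exact (mul_eq_zero.1 hw).resolve_left (mul_ne_zero h576 (pow_ne_zero 2 hG.ne_zero))

end IsIgusaModel

section Descent

variable {K L : Type*} [Field K] [Field L] [Algebra K L]

theorem mem_tangentSpace {F : MvPolynomial (Fin 5) K} {a : ℙ K (Fin 5 → K)} {v : Fin 5 → K} :
    v ∈ tangentSpace F a ↔ polar F a.rep v = 0 :=
  Iff.rfl

theorem hessian_map_coordMap (F : MvPolynomial (Fin 5) K) (p v w : Fin 5 → K) :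
    hessian (map (algebraMap K L) F) (coordMap L p) (coordMap L v) (coordMap L w) =
      algebraMap K L (hessian F p v w) :=
  map_hessian _ F p v w

theorem conicForm_map_coordMap (F : MvPolynomial (Fin 5) K) (a b : Fin 5 → K) :
    conicForm (map (algebraMap K L) F) (coordMap L a) (coordMap L b) =
      map (algebraMap K L) (conicForm F a b) :=
  (map_conicForm _ F a b).symm

variable [Infinite L] {F : MvPolynomial (Fin 5) K} {a b : ℙ K (Fin 5 → K)}
  {M : Matrix (Fin 6) (Fin 5) L} {c : L} (hG : IsIgusaModel (map (algebraMap K L) F) M c)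
  (h : IsPolarPair (M *ᵥ coordMap L a.rep) (M *ᵥ coordMap L b.rep))
  (h2 : (2 : L) ≠ 0) (h3 : (3 : L) ≠ 0)
include hG h h2 h3

theorem isConic_conicForm (hF : F.IsHomogeneous 4) :
    IsConic (tangentSpace F a ⊓ tangentSpace F b) (conicForm F a.rep b.rep) where
  finrank_eq := finrank_ker_inf_ker <| linearIndependent_of_coordMap (polar_map_coordMap F a.rep)
    (polar_map_coordMap F b.rep) (hG.linearIndependent_polar h h2 h3)
  isHomogeneous := isHomogeneous_conicForm hF a.rep b.rep
  nonsingular w hw hq := by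
    have hle := ker_inf_ker_le_ker_of_coordMap (polar_map_coordMap (L := L) F a.rep)
      (polar_map_coordMap F b.rep) (polar_map_coordMap (conicForm F a.rep b.rep) w) hq
    rw [← conicForm_map_coordMap] at hle
    refine coordMap_injective L (Eq.trans ?_ (map_zero (coordMap L)).symm)
    refine hG.eq_zero_of_polar_conicForm_eq_zero h h2 h3 ?_ ?_ fun v hav hbv => hle ⟨hav, hbv⟩
    · rw [polar_map_coordMap, mem_tangentSpace.1 hw.1, map_zero]
    · rw [polar_map_coordMap, mem_tangentSpace.1 hw.2, map_zero]

theorem sub_conicForm_sq_mem_linearIdeal :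
    C (32 * hessian F a.rep b.rep b.rep ^ 3) * F - conicForm F a.rep b.rep ^ 2 ∈
      linearIdeal (tangentSpace F a ⊓ tangentSpace F b) := by
  refine mem_linearIdeal_of_eval_eq_zero (L := L) fun v hv => ?_
  have hspan : Submodule.span L (coordMap L ''
      ((tangentSpace F a ⊓ tangentSpace F b : Submodule K (Fin 5 → K)) : Set (Fin 5 → K))) ≤
        LinearMap.ker (polar (map (algebraMap K L) F) (coordMap L a.rep)) ⊓
          LinearMap.ker (polar (map (algebraMap K L) F) (coordMap L b.rep)) := by
    refine Submodule.span_le.2 ?_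
    rintro _ ⟨w, ⟨haw, hbw⟩, rfl⟩
    constructor <;> rw [SetLike.mem_coe, LinearMap.mem_ker, polar_map_coordMap]
    · rw [mem_tangentSpace.1 haw, map_zero]
    · rw [mem_tangentSpace.1 hbw, map_zero]
  have hsq := hG.conicForm_sq_eq h h2 h3 (hspan hv).1 (hspan hv).2
  rw [conicForm_map_coordMap, hessian_map_coordMap] at hsq
  simp only [map_sub, map_mul, map_pow, map_C, eval_C, map_ofNat, hsq, sub_self]

theorem isDoubleConic_sectionIdeal (hF : F.IsHomogeneous 4) :
    IsDoubleConic (sectionIdeal (tangentSpace F a ⊓ tangentSpace F b) F)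
      (tangentSpace F a ⊓ tangentSpace F b) (conicForm F a.rep b.rep) := by
  refine ⟨isConic_conicForm hG h h2 h3 hF, sectionIdeal_eq_of_sub_mem (fun h0 => ?_)
    (sub_conicForm_sq_mem_linearIdeal hG h h2 h3)⟩
  have h32 : (32 : L) ≠ 0 := by
    rw [show (32 : L) = 2 ^ 5 by norm_num]
    exact pow_ne_zero 5 h2
  refine mul_ne_zero h32 (pow_ne_zero 3 (hG.hessian_ne_zero h h2 h3)) ?_
  rw [hessian_map_coordMap, ← map_pow, ← map_ofNat (algebraMap K L) 32, ← map_mul, h0, map_zero]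

theorem isTrope_inf (hF : F.IsHomogeneous 4) {T : Submodule K (Fin 5 → K)}
    (hT : tangentSpace F a ⊓ tangentSpace F b ≤ T) :
    IsTrope T F (tangentSpace F a ⊓ tangentSpace F b) :=
  ⟨hT, conicForm F a.rep b.rep,
    (linearIdeal_sup_sectionIdeal hT F).symm ▸ isDoubleConic_sectionIdeal hG h h2 h3 hF⟩

theorem isDoubleConic_kummer_sup_kummer (hF : F.IsHomogeneous 4) :
    IsDoubleConic (kummer F a ⊔ kummer F b) (tangentSpace F a ⊓ tangentSpace F b)
      (conicForm F a.rep b.rep) :=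
  (sectionIdeal_sup_sectionIdeal _ _ F).symm ▸ isDoubleConic_sectionIdeal hG h h2 h3 hF

end Descent

theorem polarConic_self_smul {R : Type*} [CommRing R] (x y z : Fin 6 → R) (r : R) :
    polarConic x y (r • z) (r • z) = r ^ 2 * polarConic x y z z := by
  simp only [polarConic, polar₄_smul₃, polar₄_smul₄]
  ring

theorem polarConic_left {R : Type*} [CommRing R] {x y : Fin 6 → R} (h : polar₄ x x x y = 0) :
    polarConic x y x x = 0 := by
  rw [polarConic, polar₄_swap₂₃ x y, polar₄_swap₃₄ x x y x, h]
  ring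

theorem polarConic_right {R : Type*} [CommRing R] {x y : Fin 6 → R} (h : polar₄ y y y x = 0) :
    polarConic x y y y = 0 := by
  rw [polarConic, polar₄_swap₁₂ x y, polar₄_swap₂₃ y x, polar₄_swap₃₄ y y x y, h]
  ring

theorem mk_ne_mk_of_mulVec_ne_smul {L : Type*} [Field L] {M : Matrix (Fin 6) (Fin 5) L}
    {u p : Fin 5 → L} (hu : u ≠ 0) (hp : p ≠ 0)
    (h : ∀ r : L, M *ᵥ p ≠ r • M *ᵥ u) :
    Projectivization.mk L p hp ≠ Projectivization.mk L u hu := by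
  rw [Ne, Projectivization.mk_eq_mk_iff']
  rintro ⟨r, rfl⟩
  exact h r (Matrix.mulVec_smul M r u)

namespace IsIgusaModel

variable {L : Type*} [Field L] {G : MvPolynomial (Fin 5) L} {M : Matrix (Fin 6) (Fin 5) L} {c : L}
  (hG : IsIgusaModel G M c) {u v : Fin 5 → L}
include hG

theorem tangentSpace_mk (h2 : (2 : L) ≠ 0) (hu : u ≠ 0) :
    tangentSpace G (Projectivization.mk L u hu) = LinearMap.ker (polar G u) := by
  obtain ⟨t, ht⟩ := Projectivization.exists_smul_eq_mk_rep L u hu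
  ext w
  rw [mem_tangentSpace, LinearMap.mem_ker, hG.polar_eq_zero_iff h2, hG.polar_eq_zero_iff h2, ← ht,
    Units.smul_def, Matrix.mulVec_smul, polar₄_smul₁, polar₄_smul₂, polar₄_smul₃]
  simp only [mul_eq_zero, t.ne_zero, false_or]

theorem isNode_mk (h2 : (2 : L) ≠ 0) (h3 : (3 : L) ≠ 0) (hu : polar G u ≠ 0) {p : Fin 5 → L}
    (hp : p ≠ 0) (h : IsSectionNode (M *ᵥ u) (M *ᵥ p)) :
    IsNode (LinearMap.ker (polar G u)) G (Projectivization.mk L p hp) := by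
  obtain ⟨t, ht⟩ := Projectivization.exists_smul_eq_mk_rep L p hp
  have hrep : M *ᵥ (Projectivization.mk L p hp).rep = (t : L) • M *ᵥ p := by
    rw [← ht, Units.smul_def, Matrix.mulVec_smul]
  refine ⟨?_, ?_, ?_, fun w _ => ?_, fun w hw hker => ?_⟩
  · have := Module.Dual.finrank_ker_add_one_of_ne_zero hu
    rw [Module.finrank_fin_fun] at this
    exact Nat.succ_injective this
  · rw [LinearMap.mem_ker, hG.polar_eq_zero_iff h2, hrep, polar₄_smul₄, h.polar_eq, mul_zero]
  · rw [hG.eval_eq, hrep, polar₄_smul₁, polar₄_smul₂, polar₄_smul₃, polar₄_smul₄,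
      h.singular _ h.sum_eq]
    simp only [mul_zero]
  · rw [hG.polar_eq_zero_iff h2, hrep, polar₄_smul₁, polar₄_smul₂, polar₄_smul₃,
      h.singular _ (hG.sum_mulVec w)]
    simp only [mul_zero]
  · have h12 : (12 : L) ≠ 0 := by
      rw [show (12 : L) = 2 ^ 2 * 3 by norm_num]
      exact mul_ne_zero (pow_ne_zero 2 h2) h3
    obtain ⟨r, hr⟩ := h.nondegenerate (M *ᵥ w) (hG.sum_mulVec w)
      ((hG.polar_eq_zero_iff h2 _ _).1 hw) fun z hz huz => by
        obtain ⟨z, rfl⟩ := hG.exists_mulVec_eq hz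
        have := hker z ((hG.polar_eq_zero_iff h2 _ _).2 huz)
        simpa only [hG.hessian_eq, hrep, polar₄_smul₁, polar₄_smul₂, mul_eq_zero, h12, hG.ne_zero,
          t.ne_zero, false_or] using this
    rw [← Matrix.mulVec_smul] at hr
    rw [hG.injective hr, ← ht, Submodule.mem_span_singleton]
    exact ⟨r * (t : L)⁻¹, by rw [Units.smul_def, smul_smul, inv_mul_cancel_right₀ t.ne_zero]⟩

theorem exists_nodes [Infinite L] (h : IsPolarPair (M *ᵥ u) (M *ᵥ v)) (h2 : (2 : L) ≠ 0)
    (h3 : (3 : L) ≠ 0) (hu : u ≠ 0) (hv : v ≠ 0) :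
    ∃ S : Finset (ℙ L (Fin 5 → L)), S.card = 5 ∧ Projectivization.mk L u hu ∉ S ∧
      Projectivization.mk L v hv ∉ S ∧ ∀ p ∈ S,
        p ∈ conicPoints (LinearMap.ker (polar G u) ⊓ LinearMap.ker (polar G v))
          (conicForm G u v) ∧
        IsNode (LinearMap.ker (polar G u)) G p ∧ IsNode (LinearMap.ker (polar G v)) G p := by
  obtain ⟨z, hz, hzu, hzv, hzz⟩ := h.exists_isCommonNode h2 h3
  choose p hp using fun j => hG.exists_mulVec_eq (hz j).left.sum_eq
  simp only [← hp] at hz hzu hzv hzz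
  have hp0 (j : Fin 5) : p j ≠ 0 := fun h0 => hzu j 0 <| by
    rw [h0, Matrix.mulVec_zero, zero_smul]
  have hinj : Function.Injective fun j => Projectivization.mk L (p j) (hp0 j) := fun i j hij => by
    by_contra hne
    exact mk_ne_mk_of_mulVec_ne_smul (hp0 j) (hp0 i) (hzz i j hne) hij
  have hindep := hG.linearIndependent_polar h h2 h3
  refine ⟨Finset.univ.map ⟨_, hinj⟩, by rw [Finset.card_map, Finset.card_fin], ?_, ?_, ?_⟩
  · simpa using fun j => mk_ne_mk_of_mulVec_ne_smul hu (hp0 j) (hzu j)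
  · simpa using fun j => mk_ne_mk_of_mulVec_ne_smul hv (hp0 j) (hzv j)
  · simp only [Finset.mem_map, Finset.mem_univ, true_and, Function.Embedding.coeFn_mk,
      forall_exists_index, forall_apply_eq_imp_iff]
    intro j
    have hnodeu := hG.isNode_mk h2 h3 (hindep.ne_zero 0) (hp0 j) (hz j).left
    have hnodev := hG.isNode_mk h2 h3 (hindep.ne_zero 1) (hp0 j) (hz j).right
    refine ⟨⟨⟨hnodeu.mem, hnodev.mem⟩, ?_⟩, hnodeu, hnodev⟩
    obtain ⟨t, ht⟩ := Projectivization.exists_smul_eq_mk_rep L (p j) (hp0 j)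
    rw [← ht, Units.smul_def, hG.eval_conicForm, Matrix.mulVec_smul, polarConic_self_smul,
      (hz j).polarConic_eq, mul_zero, mul_zero]

end IsIgusaModel

section Points

variable {K L : Type*} [Field K] [Field L] [Algebra K L]

theorem eval_map_coordMap (F : MvPolynomial (Fin 5) K) (p : Fin 5 → K) :
    eval (coordMap L p) (map (algebraMap K L) F) = algebraMap K L (eval p F) :=
  (map_eval _ p F).symm

theorem coordMap_rep_ne_zero (a : ℙ K (Fin 5 → K)) : coordMap L a.rep ≠ 0 := fun h0 =>
  a.rep_nonzero (coordMap_injective L (h0.trans (map_zero (coordMap L)).symm))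

theorem pointMap_eq_mk (a : ℙ K (Fin 5 → K)) :
    pointMap L a = Projectivization.mk L (coordMap L a.rep) (coordMap_rep_ne_zero a) := by
  conv_lhs => rw [← a.mk_rep]
  rw [pointMap, Projectivization.map_mk]

variable {F : MvPolynomial (Fin 5) K} {M : Matrix (Fin 6) (Fin 5) L} {c : L}
  (hG : IsIgusaModel (map (algebraMap K L) F) M c)
include hG

theorem polar_eq_zero_of_polar₄_eq_zero {a b : Fin 5 → K}
    (h : polar₄ (M *ᵥ coordMap L a) (M *ᵥ coordMap L a) (M *ᵥ coordMap L a)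
      (M *ᵥ coordMap L b) = 0) : polar F a b = 0 := by
  apply (algebraMap K L).injective
  rw [← polar_map_coordMap, hG.polar_eq, h, mul_zero, map_zero]

theorem eval_conicForm_eq_zero {a b v : Fin 5 → K}
    (h : polarConic (M *ᵥ coordMap L a) (M *ᵥ coordMap L b) (M *ᵥ coordMap L v)
      (M *ᵥ coordMap L v) = 0) : eval v (conicForm F a b) = 0 := by
  apply (algebraMap K L).injective
  rw [map_zero, ← eval_map_coordMap, ← conicForm_map_coordMap, hG.eval_conicForm, h, mul_zero]

theorem left_mem_conicPoints {a b : ℙ K (Fin 5 → K)}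
    (h : IsPolarPair (M *ᵥ coordMap L a.rep) (M *ᵥ coordMap L b.rep)) :
    a ∈ conicPoints (tangentSpace F a ⊓ tangentSpace F b) (conicForm F a.rep b.rep) := by
  refine ⟨⟨polar_eq_zero_of_polar₄_eq_zero hG h.left.polar₄_eq,
    polar_eq_zero_of_polar₄_eq_zero hG h.polar_right⟩, eval_conicForm_eq_zero hG ?_⟩
  exact polarConic_left h.polar_left

theorem right_mem_conicPoints {a b : ℙ K (Fin 5 → K)}
    (h : IsPolarPair (M *ᵥ coordMap L a.rep) (M *ᵥ coordMap L b.rep)) :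
    b ∈ conicPoints (tangentSpace F a ⊓ tangentSpace F b) (conicForm F a.rep b.rep) := by
  refine ⟨⟨polar_eq_zero_of_polar₄_eq_zero hG h.polar_left,
    polar_eq_zero_of_polar₄_eq_zero hG h.right.polar₄_eq⟩, eval_conicForm_eq_zero hG ?_⟩
  exact polarConic_right h.polar_right

end Points

theorem map_igusaForm {E L : Type*} [Field E] [Field L] (f : E →+* L) :
    map f (igusaForm E) = igusaForm L := by
  simp only [igusaForm, map_sub, map_mul, map_pow, map_sum, map_ofNat, map_X]

theorem polar₄_self_eq_three_mul_bind₁_igusaForm {L : Type*} [Field L]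
    (l : Fin 6 → MvPolynomial (Fin 5) L) :
    polar₄ l l l l = 3 * bind₁ l (igusaForm L) := by
  simp only [igusaForm, polar₄, dotProduct, map_sub, map_mul, map_pow, map_sum, map_ofNat,
    bind₁_X_right, ← pow_two]
  simp only [← pow_succ]
  ring

section BaseExtension

variable {k E L : Type*} [Field k] [Field E] [Field L] [Algebra k E] [Algebra k L] [Algebra E L]
  [IsScalarTower k E L] {F : MvPolynomial (Fin 5) k} {φ : (Fin 5 → E) ≃ₗ[E] sumZero E}

/-- The matrix over `L` of an isomorphism from `E⁵` to the hyperplane `∑ xⱼ = 0` in `E⁶`. -/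
def extendedMatrix (L : Type*) [Field L] [Algebra E L] (φ : (Fin 5 → E) ≃ₗ[E] sumZero E) :
    Matrix (Fin 6) (Fin 5) L :=
  (LinearMap.toMatrix' ((sumZero E).subtype ∘ₗ φ.toLinearMap)).map (algebraMap E L)

theorem extendedMatrix_mulVec_coordMap (v : Fin 5 → E) :
    extendedMatrix L φ *ᵥ coordMap L v = algebraMap E L ∘ (φ v : Fin 6 → E) := by
  have hmulVec : LinearMap.toMatrix' ((sumZero E).subtype ∘ₗ φ.toLinearMap) *ᵥ v = φ v :=
    LinearMap.toMatrix'_mulVec _ v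
  rw [← hmulVec]
  ext j
  exact (RingHom.map_mulVec (algebraMap E L) _ v j).symm

theorem coordMap_coordMap (v : Fin 5 → k) : coordMap L (coordMap E v) = coordMap L v :=
  funext fun i => (IsScalarTower.algebraMap_apply k E L (v i)).symm

theorem extendedMatrix_injective : Function.Injective (extendedMatrix L φ).mulVec := by
  obtain ⟨g, hg⟩ := LinearMap.exists_leftInverse_of_injective
    ((sumZero E).subtype ∘ₗ φ.toLinearMap)
    (LinearMap.ker_eq_bot.2 ((sumZero E).subtype_injective.comp φ.injective))
  have hinv : (LinearMap.toMatrix' g).map (algebraMap E L) * extendedMatrix L φ = 1 := by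
    rw [extendedMatrix, ← Matrix.map_mul, ← LinearMap.toMatrix'_comp, hg, LinearMap.toMatrix'_id,
      Matrix.map_one _ (map_zero _) (map_one _)]
  refine Function.LeftInverse.injective
    (g := ((LinearMap.toMatrix' g).map (algebraMap E L)).mulVec) fun v => ?_
  rw [Matrix.mulVec_mulVec, hinv, Matrix.one_mulVec]

theorem extendedMatrix_apply (j : Fin 6) (i : Fin 5) :
    extendedMatrix L φ j i = algebraMap E L ((φ (Pi.single i 1) : Fin 6 → E) j) := by
  rw [extendedMatrix, Matrix.map_apply, LinearMap.toMatrix'_apply, LinearMap.comp_apply,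
    LinearEquiv.coe_coe, Submodule.subtype_apply]

theorem sum_extendedMatrix_mulVec (v : Fin 5 → L) : ∑ j, (extendedMatrix L φ *ᵥ v) j = 0 := by
  have hcol (i : Fin 5) : ∑ j, extendedMatrix L φ j i = 0 := by
    simp only [extendedMatrix_apply, ← map_sum, mem_sumZero.1 (φ (Pi.single i 1)).2, map_zero]
  simp only [Matrix.mulVec, dotProduct]
  rw [Finset.sum_comm]
  simp only [← Finset.sum_mul, hcol, zero_mul, Finset.sum_const_zero]

theorem IsIsoToIgusa.exists_isIgusaModel (h3 : (3 : L) ≠ 0) (h : IsIsoToIgusa E F φ) :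
    ∃ c : L, IsIgusaModel (map (algebraMap k L) F) (extendedMatrix L φ) c := by
  obtain ⟨c, hc, hF⟩ := h
  refine ⟨algebraMap E L c / 3, div_ne_zero ((map_ne_zero _).2 hc) h3, ?_,
    sum_extendedMatrix_mulVec, extendedMatrix_injective⟩
  rw [IsScalarTower.algebraMap_eq k E L, ← map_map, hF, map_mul, map_C,
    polar₄_self_eq_three_mul_bind₁_igusaForm, map_bind₁, map_igusaForm]
  have hforms : (fun j => map (algebraMap E L)
      (∑ i, C ((φ (Pi.single i 1) : Fin 6 → E) j) * X i)) = coordForms (extendedMatrix L φ) := by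
    ext1 j
    simp only [coordForms, linearForm, extendedMatrix_apply, map_sum, map_mul, map_C, map_X]
  have h3C : (C (algebraMap E L c / 3) * 3 : MvPolynomial (Fin 5) L) = C (algebraMap E L c) := by
    rw [← map_ofNat C 3, ← C_mul, div_mul_cancel₀ _ h3]
  rw [hforms, ← mul_assoc, h3C]

theorem isGeneralPoint {c : L} (hG : IsIgusaModel (map (algebraMap k L) F) (extendedMatrix L φ) c)
    {a : ℙ k (Fin 5 → k)} (ha : eval a.rep F = 0) (haE : a ∉ exceptional E φ) :
    IsGeneralPoint (extendedMatrix L φ *ᵥ coordMap L a.rep) where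
  sum_eq := hG.sum_mulVec _
  polar₄_eq := by
    have heval := hG.eval_eq (coordMap L a.rep)
    rw [eval_map_coordMap, ha, map_zero, eq_comm] at heval
    exact (mul_eq_zero.1 heval).resolve_left hG.ne_zero
  triple_ne i j l hij hil hjl h0 := by
    obtain ⟨σ, rfl, rfl, rfl⟩ := exists_perm_fin_six hij hil hjl
    refine haE ⟨σ, ?_⟩
    rw [← coordMap_coordMap (E := E), extendedMatrix_mulVec_coordMap] at h0
    simp only [Function.comp_apply, ← map_add, map_eq_zero] at h0
    exact h0

theorem eq_of_coordMap_eq_smul {a b : ℙ k (Fin 5 → k)} {r : L}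
    (h : coordMap L b.rep = r • coordMap L a.rep) : a = b := by
  obtain ⟨i, hi⟩ := Function.ne_iff.1 a.rep_nonzero
  have hcoord (j : Fin 5) : algebraMap k L (b.rep j) = r * algebraMap k L (a.rep j) := congrFun h j
  have hr : r = algebraMap k L (b.rep i / a.rep i) := by
    rw [map_div₀, hcoord, mul_div_cancel_right₀ _ ((map_ne_zero _).2 hi)]
  rw [← a.mk_rep, ← b.mk_rep, eq_comm, Projectivization.mk_eq_mk_iff']
  refine ⟨b.rep i / a.rep i, coordMap_injective L ?_⟩
  rw [h, hr, map_smulₛₗ]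

theorem isPolarPair (h2 : (2 : L) ≠ 0) {c : L}
    (hG : IsIgusaModel (map (algebraMap k L) F) (extendedMatrix L φ) c)
    {a b : ℙ k (Fin 5 → k)} (hab : a ≠ b) (ha : eval a.rep F = 0) (hb : eval b.rep F = 0)
    (haE : a ∉ exceptional E φ) (hbE : b ∉ exceptional E φ)
    (hPab : polar F a.rep b.rep = 0) (hPba : polar F b.rep a.rep = 0) :
    IsPolarPair (extendedMatrix L φ *ᵥ coordMap L a.rep)
      (extendedMatrix L φ *ᵥ coordMap L b.rep) where
  left := isGeneralPoint hG ha haE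
  right := isGeneralPoint hG hb hbE
  polar_left := by rw [← hG.polar_eq_zero_iff h2, polar_map_coordMap, hPab, map_zero]
  polar_right := by rw [← hG.polar_eq_zero_iff h2, polar_map_coordMap, hPba, map_zero]
  ne_smul r hr := by
    rw [← Matrix.mulVec_smul] at hr
    exact hab (eq_of_coordMap_eq_smul (hG.injective hr))

end BaseExtension

theorem exists_nodes_pointMap {k L : Type*} [Field k] [Field L] [Algebra k L] [Infinite L]
    {F : MvPolynomial (Fin 5) k} {a b : ℙ k (Fin 5 → k)} {M : Matrix (Fin 6) (Fin 5) L} {c : L}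
    (hG : IsIgusaModel (map (algebraMap k L) F) M c)
    (h : IsPolarPair (M *ᵥ coordMap L a.rep) (M *ᵥ coordMap L b.rep))
    (h2 : (2 : L) ≠ 0) (h3 : (3 : L) ≠ 0) :
    ∃ S : Finset (ℙ L (Fin 5 → L)), S.card = 5 ∧ pointMap L a ∉ S ∧ pointMap L b ∉ S ∧ ∀ p ∈ S,
      p ∈ conicPoints (tangentSpace (map (algebraMap k L) F) (pointMap L a) ⊓
        tangentSpace (map (algebraMap k L) F) (pointMap L b))
        (map (algebraMap k L) (conicForm F a.rep b.rep)) ∧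
      IsNode (tangentSpace (map (algebraMap k L) F) (pointMap L a)) (map (algebraMap k L) F) p ∧
      IsNode (tangentSpace (map (algebraMap k L) F) (pointMap L b)) (map (algebraMap k L) F) p := by
  rw [pointMap_eq_mk a, pointMap_eq_mk b, hG.tangentSpace_mk h2, hG.tangentSpace_mk h2,
    ← conicForm_map_coordMap]
  exact hG.exists_nodes h h2 h3 _ _

end IgusaQuartic

end

open IgusaQuartic MvPolynomial in
theorem propositionP_general {k E L : Type*} [Field k] [Field E] [Field L] [Infinite L]
    [Algebra k E] [Algebra k L] [Algebra E L] [IsScalarTower k E L]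
    (h2 : (2 : k) ≠ 0) (h3 : (3 : k) ≠ 0)
    (F : MvPolynomial (Fin 5) k) (hF : F.IsHomogeneous 4)
    (φ : (Fin 5 → E) ≃ₗ[E] sumZero E) (hφ : IsIsoToIgusa E F φ)
    (a b : ℙ k (Fin 5 → k)) (hab : a ≠ b) (ha : eval a.rep F = 0) (hb : eval b.rep F = 0)
    (haE : a ∉ exceptional E φ) (hbE : b ∉ exceptional E φ)
    (hPab : polar F a.rep b.rep = 0) (hPba : polar F b.rep a.rep = 0) :
    IsTrope (tangentSpace F a) F (tangentSpace F a ⊓ tangentSpace F b) ∧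
    IsTrope (tangentSpace F b) F (tangentSpace F a ⊓ tangentSpace F b) ∧
    ∃ q : MvPolynomial (Fin 5) k,
      IsDoubleConic (kummer F a ⊔ kummer F b) (tangentSpace F a ⊓ tangentSpace F b) q ∧
      a ∈ conicPoints (tangentSpace F a ⊓ tangentSpace F b) q ∧
      b ∈ conicPoints (tangentSpace F a ⊓ tangentSpace F b) q ∧
      ∃ S : Finset (ℙ L (Fin 5 → L)),
        let FL := map (algebraMap k L) F
        let aL := pointMap L a
        let bL := pointMap L b
        S.card = 5 ∧ aL ∉ S ∧ bL ∉ S ∧ ∀ p ∈ S,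
          p ∈ conicPoints (tangentSpace FL aL ⊓ tangentSpace FL bL) (map (algebraMap k L) q) ∧
          IsNode (tangentSpace FL aL) FL p ∧ IsNode (tangentSpace FL bL) FL p := by
  have h2L : (2 : L) ≠ 0 := by
    rw [← map_ofNat (algebraMap k L) 2]
    exact (map_ne_zero _).2 h2
  have h3L : (3 : L) ≠ 0 := by
    rw [← map_ofNat (algebraMap k L) 3]
    exact (map_ne_zero _).2 h3
  obtain ⟨c, hG⟩ := hφ.exists_isIgusaModel h3L
  have h := isPolarPair h2L hG hab ha hb haE hbE hPab hPba
  exact ⟨isTrope_inf hG h h2L h3L hF inf_le_left, isTrope_inf hG h h2L h3L hF inf_le_right,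
    conicForm F a.rep b.rep, isDoubleConic_kummer_sup_kummer hG h h2L h3L hF,
    left_mem_conicPoints hG h, right_mem_conicPoints hG h, exists_nodes_pointMap hG h h2L h3L⟩

theorem propositionP {k : Type*} [Field k] (h2 : (2 : k) ≠ 0) (h3 : (3 : k) ≠ 0)
    -- an Igusa quartic over `k`, with an isomorphism to the standard one over `kˢᵉᵖ`
    (F : MvPolynomial (Fin 5) k) (hF : F.IsHomogeneous 4)
    (φ : (Fin 5 → SeparableClosure k) ≃ₗ[SeparableClosure k]
      IgusaQuartic.sumZero (SeparableClosure k))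
    (hφ : IgusaQuartic.IsIsoToIgusa (SeparableClosure k) F φ)
    -- distinct points of the quartic, outside the exceptional locus
    (a b : ℙ k (Fin 5 → k)) (hab : a ≠ b)
    (ha : MvPolynomial.eval a.rep F = 0) (hb : MvPolynomial.eval b.rep F = 0)
    (haE : a ∉ IgusaQuartic.exceptional (SeparableClosure k) φ)
    (hbE : b ∉ IgusaQuartic.exceptional (SeparableClosure k) φ)
    (hPab : IgusaQuartic.polar F a.rep b.rep = 0)
    (hPba : IgusaQuartic.polar F b.rep a.rep = 0) :
    -- the intersection of the tangent spaces is a trope of both surfaces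
    IgusaQuartic.IsTrope (IgusaQuartic.tangentSpace F a) F
      (IgusaQuartic.tangentSpace F a ⊓ IgusaQuartic.tangentSpace F b) ∧
    IgusaQuartic.IsTrope (IgusaQuartic.tangentSpace F b) F
      (IgusaQuartic.tangentSpace F a ⊓ IgusaQuartic.tangentSpace F b) ∧
    -- the intersection of the surfaces is a double conic
    ∃ q : MvPolynomial (Fin 5) k,
      IgusaQuartic.IsDoubleConic (IgusaQuartic.kummer F a ⊔ IgusaQuartic.kummer F b)
        (IgusaQuartic.tangentSpace F a ⊓ IgusaQuartic.tangentSpace F b) q ∧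
      a ∈ IgusaQuartic.conicPoints
        (IgusaQuartic.tangentSpace F a ⊓ IgusaQuartic.tangentSpace F b) q ∧
      b ∈ IgusaQuartic.conicPoints
        (IgusaQuartic.tangentSpace F a ⊓ IgusaQuartic.tangentSpace F b) q ∧
      -- and it passes through five common nodes, other than `a` and `b`, over the algebraic closure
      ∃ S : Finset (ℙ (AlgebraicClosure k) (Fin 5 → AlgebraicClosure k)),
        let Fbar := MvPolynomial.map (algebraMap k (AlgebraicClosure k)) F
        let abar := IgusaQuartic.pointMap (AlgebraicClosure k) a
        let bbar := IgusaQuartic.pointMap (AlgebraicClosure k) b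
        S.card = 5 ∧ abar ∉ S ∧ bbar ∉ S ∧
        ∀ p ∈ S,
          p ∈ IgusaQuartic.conicPoints
            (IgusaQuartic.tangentSpace Fbar abar ⊓ IgusaQuartic.tangentSpace Fbar bbar)
            (MvPolynomial.map (algebraMap k (AlgebraicClosure k)) q) ∧
          IgusaQuartic.IsNode (IgusaQuartic.tangentSpace Fbar abar) Fbar p ∧
          IgusaQuartic.IsNode (IgusaQuartic.tangentSpace Fbar bbar) Fbar p := by
  exact propositionP_general h2 h3 F hF φ hφ a b hab ha hb haE hbE hPab hPba
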